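/- Let $k$ be a commutative Artin ring and let $\Lambda$ be an Artin $k$-algebra, that is, a $k$-algebra that is finitely generated as a $k$-module (for instance $k=Z(\Lambda)$). Let $\mathfrak r$ be the Jacobson radical of $\Lambda$, let $\operatorname{mod}\Lambda$ be the category of finitely generated left $\Lambda$-modules, let $D^b(\Lambda)$ be the bounded derived category of $\operatorname{mod}\Lambda$, and let $\operatorname{id}\Lambda$ be the injective dimension of $\Lambda$ as a left module over itself. Let $\underline{\operatorname{mod}}\,\Lambda$ be the stable category, obtained from $\operatorname{mod}\Lambda$ by factoring out the morphisms that factor through projective modules. On it let $\Sigma$ be the functor given by cokernels of left $\operatorname{add}\Lambda$-approximations, let $\Omega$ be the syzygy functor, and put $\Sigma^{d}=\Omega^{-d}$ for $d<0$. Let $\underline{\operatorname{MCM}}(\Lambda)\subseteq\underline{\operatorname{mod}}\,\Lambda$ be the full subcategory of maximal Cohen–Macaulay modules, i.e. of those $M$ with $\operatorname{Ext}^i_\Lambda(M,\Lambda)=0$ for all $i>0$. (When $\Lambda$ is Gorenstein, i.e. has finite injective dimension on both sides, $\underline{\operatorname{MCM}}(\Lambda)$ is triangulated with suspension $\Sigma$,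 whose inverse is $\Omega$.) Let $D=\operatorname{Hom}_k(-,E)$, where $E$ is a $k$-module into which every simple $k$-module embeds (for instance $E=k$, or $E$ an injective envelope of $k/\operatorname{rad}k$). Suppose that $\Lambda$ is stably symmetric, i.e. that $\underline{\operatorname{MCM}}(\Lambda)$ is weakly $d$-Calabi–Yau for some $d\in\mathbb Z$: there is a $k$-linear equivalence $S$ of $\underline{\operatorname{MCM}}(\Lambda)$ with itself, isomorphic as a functor to $\Sigma^d$, together with $k$-linear isomorphisms $\operatorname{Hom}(X,Y)\simeq D\operatorname{Hom}(Y,SX)$ that are functorial in $X$ and $Y$. Let $R=\bigoplus_{i\ge 0}R_i$ be a graded-commutative ring ($rs=(-1)^{|r||s|}sr$ for homogeneous $r,s$) acting centrally on $D^b(\Lambda)$, i.e. equipped with a homomorphism of graded rings to the graded center of $D^b(\Lambda)$, whose degree $n$ part consists of the natural transformations $f\colon\mathrm{Id}\to\Sigma^n$ with $f_{\Sigma X}=(-1)^n\Sigma f_X$ (here $\Sigma$ is the suspension of $D^b(\Lambda)$). Suppose that $\operatorname{Ext}^*_\Lambda(\Lambda/\mathfrak r,\Lambda/\mathfrak r)=\bigoplus_{i}\operatorname{Hom}_{D^b(\Lambda)}(\Lambda/\mathfrak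 r,\Sigma^i(\Lambda/\mathfrak r))$ is eventually Noetherian of finite length over $R$: there is an $n_0$ such that $\operatorname{Ext}^{\ge n_0}_\Lambda(\Lambda/\mathfrak r,\Lambda/\mathfrak r)$ is a Noetherian $R$-module, and $\operatorname{Ext}^n_\Lambda(\Lambda/\mathfrak r,\Lambda/\mathfrak r)$ has finite length over $R_0$ for all $n\ge n_0$. Then for all $M,N\in\operatorname{mod}\Lambda$ the following are equivalent: (i) $\operatorname{Ext}^i_\Lambda(M,N)=0$ for $i\gg 0$; (ii) $\operatorname{Ext}^i_\Lambda(M,N)=0$ for all $i>\operatorname{id}\Lambda$; (iii) $\operatorname{Ext}^i_\Lambda(N,M)=0$ for $i\gg 0$; (iv) $\operatorname{Ext}^i_\Lambda(N,M)=0$ for all $i>\operatorname{id}\Lambda$. -/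

import Mathlib

open CategoryTheory CategoryTheory.Abelian DirectSum

universe w u

/-! ### Central actions of graded-commutative rings -/

section CentralAction

variable {R : Type*} [Ring R]

/-- `R = ⨁ 𝒜 n` is graded-commutative: `r s = (-1)^{|r||s|} s r` for homogeneous `r`, `s`. -/
def IsGradedCommutative (𝒜 : ℕ → AddSubgroup R) : Prop :=
  ∀ ⦃m n : ℕ⦄ ⦃r s : R⦄, r ∈ 𝒜 m → s ∈ 𝒜 n → r * s = (-1) ^ (m * n) * (s * r)

variable (T : Type*) [Category T] [Preadditive T] [HasShift T ℤ]
  [∀ n : ℤ, (shiftFunctor T n).Additive]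

/-- The degree `n` component `Zⁿ(T)` of the graded center of `T`: natural transformations
`f : Id ⟶ Σⁿ` with `f_{ΣX} = (-1)ⁿ Σ f_X`, where `ΣΣⁿX` and `ΣⁿΣX` are identified through the
canonical isomorphism. -/
def gradedCenter (n : ℤ) : AddSubgroup (𝟭 T ⟶ shiftFunctor T n) where
  carrier := {f | ∀ X : T, f.app (X⟦(1 : ℤ)⟧) =
    n.negOnePow • ((f.app X)⟦(1 : ℤ)⟧' ≫ (shiftComm X n (1 : ℤ)).hom)}
  zero_mem' X := by simp
  add_mem' {f g} hf hg X := by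
    have h1 := hf X
    have h2 := hg X
    rw [NatTrans.app_add, NatTrans.app_add, h1, h2, Functor.map_add, Preadditive.add_comp,
      smul_add]
  neg_mem' {f} hf X := by
    have h1 := hf X
    rw [NatTrans.app_neg, NatTrans.app_neg, h1, Functor.map_neg, Preadditive.neg_comp, smul_neg]

/-- The component at `X` of a degree `n` element of the graded center, as an element of
`Hom(X, ΣⁿX)`. -/
abbrev centerApp {T : Type*} [Category T] [Preadditive T] [HasShift T ℤ]
    [∀ n : ℤ, (shiftFunctor T n).Additive] {n : ℤ} (f : gradedCenter T n) (X : T) :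
    ShiftedHom X X n :=
  f.1.app X

/-- A central action of the graded ring `R = ⨁ 𝒜 n` on `T`: a homomorphism of graded rings from
`R` to the graded center of `T`. The product of `f : Id ⟶ Σᵐ` and `g : Id ⟶ Σⁿ` in the graded
center is `X ⟶ ΣⁿX ⟶ Σᵐ⁺ⁿX`, first `g_X` and then `Σⁿ f_X`. -/
structure CentralAction (𝒜 : ℕ → AddSubgroup R) [GradedRing 𝒜] where
  /-- The degree `n` part of the homomorphism. -/
  toCenter (n : ℕ) : 𝒜 n →+ gradedCenter T (n : ℤ)
  map_one (X : T) : centerApp (toCenter 0 ⟨1, SetLike.GradedOne.one_mem⟩) X =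
    ShiftedHom.mk₀ _ Nat.cast_zero (𝟙 X)
  map_mul {m n : ℕ} (r : 𝒜 m) (s : 𝒜 n) (X : T) :
    centerApp (toCenter (m + n) ⟨r.1 * s.1, SetLike.GradedMul.mul_mem r.2 s.2⟩) X =
      (centerApp (toCenter n s) X).comp (centerApp (toCenter m r) X) (Nat.cast_add m n).symm

namespace CentralAction

variable {T} {𝒜 : ℕ → AddSubgroup R} [GradedRing 𝒜] (act : CentralAction T 𝒜)

/-- The graded group `Hom*(X, Y) = ⨁_{i ∈ ℤ} Hom(X, Σⁱ Y)`, on which `R` acts through `act`. -/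
def HomStar (_act : CentralAction T 𝒜) (X Y : T) : Type _ :=
  ⨁ i : ℤ, ShiftedHom X Y i

noncomputable instance (X Y : T) : AddCommGroup (act.HomStar X Y) :=
  inferInstanceAs (AddCommGroup (⨁ i : ℤ, ShiftedHom X Y i))

variable {X Y : T}

/-- The homogeneous component of degree `i` of an element of `Hom*(X, Y)`. -/
def HomStar.coeff (x : act.HomStar X Y) (i : ℤ) : ShiftedHom X Y i :=
  (show ⨁ i : ℤ, ShiftedHom X Y i from x) i

variable (X Y) in
/-- A homogeneous element `r` of degree `n` acts on `Hom*(X, Y)` by sending `g : X ⟶ ΣᵐY` to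
`X ⟶ ΣᵐY ⟶ Σⁿ⁺ᵐY`, the second map being `Σᵐ φ_Y(r)`. -/
noncomputable def actBy (n : ℕ) (r : 𝒜 n) :
    (⨁ i : ℤ, ShiftedHom X Y i) →+ (⨁ i : ℤ, ShiftedHom X Y i) :=
  DirectSum.toAddMonoid fun m =>
    (DirectSum.of (fun i : ℤ => ShiftedHom X Y i) ((n : ℤ) + m)).comp
      (AddMonoidHom.mk' (fun g : ShiftedHom X Y m => g.comp (centerApp (act.toCenter n r) Y) rfl)
        (fun g h => ShiftedHom.add_comp g h _ rfl))

variable (X Y) in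
/-- The action of the homogeneous elements of degree `n`, as an additive map. -/
noncomputable def homogeneousAct (n : ℕ) : 𝒜 n →+ AddMonoid.End (⨁ i : ℤ, ShiftedHom X Y i) :=
  AddMonoidHom.mk' (act.actBy X Y n) (fun r s => by
    refine DirectSum.addHom_ext fun m g => ?_
    change act.actBy X Y n (r + s) _ = act.actBy X Y n r (DirectSum.of _ m g) +
      act.actBy X Y n s (DirectSum.of _ m g)
    simp only [actBy]
    rw [toAddMonoid_of, toAddMonoid_of, toAddMonoid_of]
    simp only [AddMonoidHom.comp_apply, AddMonoidHom.mk'_apply]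
    rw [← AddMonoidHom.map_add, ← ShiftedHom.comp_add, _root_.map_add]
    rfl)

lemma homogeneousAct_of (n : ℕ) (r : 𝒜 n) {m c : ℤ} (g : ShiftedHom X Y m) (h : (n : ℤ) + m = c) :
    act.homogeneousAct X Y n r (DirectSum.of (fun i : ℤ => ShiftedHom X Y i) m g) =
      DirectSum.of (fun i : ℤ => ShiftedHom X Y i) c (g.comp (centerApp (act.toCenter n r) Y) h) := by
  subst h
  exact toAddMonoid_of _ _ _

lemma homogeneousAct_apply (n : ℕ) (r : 𝒜 n) (x : ⨁ i : ℤ, ShiftedHom X Y i) {i j : ℤ}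
    (h : (n : ℤ) + i = j) :
    (act.homogeneousAct X Y n r x) j = (x i).comp (centerApp (act.toCenter n r) Y) h := by
  induction x using DirectSum.induction_on with
  | zero => simp
  | of m g =>
    rw [act.homogeneousAct_of n r g rfl]
    by_cases hm : m = i
    · subst hm
      subst h
      rw [of_eq_same, of_eq_same]
    · rw [of_eq_of_ne _ _ _ (by omega), of_eq_of_ne _ _ _ (by omega), ShiftedHom.zero_comp]
  | add x y hx hy => rw [_root_.map_add, DirectSum.add_apply, DirectSum.add_apply, hx, hy, ShiftedHom.add_comp]

variable (X Y) in
/-- The action of `R` on `Hom*(X, Y)` as a ring homomorphism. -/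
noncomputable def toEnd : R →+* AddMonoid.End (⨁ i : ℤ, ShiftedHom X Y i) :=
  (DirectSum.toSemiring (act.homogeneousAct X Y)
    (by
      refine DirectSum.addHom_ext fun m g => ?_
      have := act.homogeneousAct_of 0 ⟨1, SetLike.GradedOne.one_mem⟩ g
        (show ((0 : ℕ) : ℤ) + m = m by simp)
      rw [act.map_one, ShiftedHom.comp_mk₀_id] at this
      exact this)
    (by
      intro i j r s
      refine DirectSum.addHom_ext fun m g => ?_
      have h1 := act.homogeneousAct_of (i + j)
        ⟨r.1 * s.1, SetLike.GradedMul.mul_mem r.2 s.2⟩ g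
        (show ((i + j : ℕ) : ℤ) + m = (i : ℤ) + ((j : ℤ) + m) by push_cast; ring)
      rw [act.map_mul] at h1
      refine h1.trans ?_
      change _ = act.homogeneousAct X Y i r 
        (act.homogeneousAct X Y j s (DirectSum.of (fun i : ℤ => ShiftedHom X Y i) m g))
      rw [act.homogeneousAct_of j s g rfl, act.homogeneousAct_of i r _ rfl]
      congr 1
      exact (ShiftedHom.comp_assoc g _ _ rfl _ (by ring)).symm)).comp
    (DirectSum.decomposeRingEquiv 𝒜).toRingHom

noncomputable instance : Module R (act.HomStar X Y) :=
  letI : Module (AddMonoid.End (⨁ i : ℤ, ShiftedHom X Y i)) (act.HomStar X Y) :=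
    inferInstanceAs (Module (AddMonoid.End (⨁ i : ℤ, ShiftedHom X Y i))
      (⨁ i : ℤ, ShiftedHom X Y i))
  Module.compHom _ (act.toEnd X Y)

/-- A homogeneous `r` of degree `n` acts by `(r • x)ₙ₊ᵢ = Σⁱφ_Y(r) ∘ xᵢ`. -/
lemma HomStar.coeff_smul (n : ℕ) (r : 𝒜 n) (x : act.HomStar X Y) {i j : ℤ} (h : (n : ℤ) + i = j) :
    (r.1 • x).coeff act j = (x.coeff act i).comp (centerApp (act.toCenter n r) Y) h := by
  have h1 : act.toEnd X Y r.1 = act.homogeneousAct X Y n r := by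
    change DirectSum.toAddMonoid (act.homogeneousAct X Y) (DirectSum.decompose 𝒜 r.1) = _
    rw [DirectSum.decompose_coe, DirectSum.toAddMonoid_of]
  change (act.toEnd X Y r.1 (show ⨁ i : ℤ, ShiftedHom X Y i from x)) j = _
  rw [h1]
  exact act.homogeneousAct_apply n r _ h

variable (X Y)

/-- The `R`-submodule `Hom^{≥ n₀}(X, Y)` of `Hom*(X, Y)`. -/
noncomputable def homGE (n₀ : ℤ) : Submodule R (act.HomStar X Y) where
  carrier := {x | ∀ i < n₀, x.coeff act i = 0}
  zero_mem' _ _ := rfl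
  add_mem' {x y} hx hy i hi := by
    change x.coeff act i + y.coeff act i = 0
    rw [hx i hi, hy i hi, add_zero]
  smul_mem' r x hx := by
    induction r using DirectSum.Decomposition.inductionOn 𝒜 with
    | zero => intro i _; rw [zero_smul]; rfl
    | @homogeneous n r =>
      intro i hi
      rw [HomStar.coeff_smul act n r x (show (n : ℤ) + (i - n) = i by ring),
        hx _ (by omega), ShiftedHom.zero_comp]
    | add r s hr hs =>
      intro i hi
      rw [add_smul]
      change (r • x).coeff act i + (s • x).coeff act i = 0
      rw [hr i hi, hs i hi, add_zero]

/-- The `R₀`-module `Hom(X, ΣⁿY)`, as the degree `n` part of `Hom*(X, Y)`. -/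
noncomputable def homDegree (n : ℤ) :
    Submodule (SetLike.GradeZero.subring 𝒜) (act.HomStar X Y) where
  carrier := {x | ∀ i ≠ n, x.coeff act i = 0}
  zero_mem' _ _ := rfl
  add_mem' {x y} hx hy i hi := by
    change x.coeff act i + y.coeff act i = 0
    rw [hx i hi, hy i hi, add_zero]
  smul_mem' r x hx i hi := by
    change (r.1 • x).coeff act i = 0
    rw [HomStar.coeff_smul act 0 ⟨r.1, r.2⟩ x (show ((0 : ℕ) : ℤ) + i = i by simp), hx i hi,
      ShiftedHom.zero_comp]

/-- `Hom*(X, Y)` is eventually Noetherian of finite length over `R`: `Hom^{≥ n₀}(X, Y)` is a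
Noetherian `R`-module for some `n₀`, and `Hom(X, ΣⁿY)` has finite length over `R₀` for all
large `n`. -/
def IsEventuallyNoetherianOfFiniteLength : Prop :=
  (∃ n₀ : ℤ, IsNoetherian R (act.homGE X Y n₀)) ∧
    ∃ n₀ : ℤ, ∀ n ≥ n₀, IsFiniteLength (SetLike.GradeZero.subring 𝒜) (act.homDegree X Y n)

end CentralAction

end CentralAction

/-! ### The bounded derived category of finitely generated modules -/

section Db

variable (Λ : Type u) [Ring Λ] [HasDerivedCategory.{w} (ModuleCat.{u} Λ)]

/-- The objects of `D(Mod Λ)` with bounded and finitely generated cohomology. -/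
def isBoundedFG : ObjectProperty (DerivedCategory (ModuleCat.{u} Λ)) := fun X =>
  (∃ a b : ℤ, ∀ i : ℤ, i < a ∨ b < i →
    Limits.IsZero ((DerivedCategory.homologyFunctor (ModuleCat.{u} Λ) i).obj X)) ∧
  ∀ i : ℤ, Module.Finite Λ ((DerivedCategory.homologyFunctor (ModuleCat.{u} Λ) i).obj X)

/-- `Hⁱ(ΣⁿX)` is `Hⁿ⁺ⁱ(X)`. -/
noncomputable def homologyShiftIso (X : DerivedCategory (ModuleCat.{u} Λ)) (n i : ℤ) :
    (DerivedCategory.homologyFunctor (ModuleCat.{u} Λ) i).obj (X⟦n⟧) ≅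
      (DerivedCategory.homologyFunctor (ModuleCat.{u} Λ) (n + i)).obj X :=
  ((DerivedCategory.homologyFunctor (ModuleCat.{u} Λ) 0).shiftIso n i (n + i) rfl).app X

instance : (isBoundedFG Λ).IsStableUnderShift ℤ where
  isStableUnderShiftBy n := ⟨fun X hX => by
    obtain ⟨⟨a, b, hab⟩, hfg⟩ := hX
    refine ⟨⟨a - n, b - n, fun i hi => ?_⟩, fun i => ?_⟩
    · exact (hab (n + i) (by omega)).of_iso (homologyShiftIso Λ X n i)
    · have := hfg (n + i)
      exact Module.Finite.equiv (homologyShiftIso Λ X n i).toLinearEquiv.symm⟩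

/-- The bounded derived category `Dᵇ(Λ)` of finitely generated left `Λ`-modules (for a Noetherian
ring `Λ`), as the full subcategory of `D(Mod Λ)` of objects with bounded and finitely generated
cohomology. -/
abbrev BoundedDerivedCategory := (isBoundedFG Λ).FullSubcategory

variable {Λ} in
/-- A finitely generated module, seen as a complex concentrated in degree zero. -/
noncomputable def BoundedDerivedCategory.ofModule (M : ModuleCat.{u} Λ) [Module.Finite Λ M] :
    BoundedDerivedCategory Λ :=
  ⟨(DerivedCategory.singleFunctor (ModuleCat.{u} Λ) 0).obj M, by
    have h0 : ∀ i : ℤ, i ≠ 0 → Limits.IsZero ((DerivedCategory.homologyFunctor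
        (ModuleCat.{u} Λ) i).obj ((DerivedCategory.singleFunctor (ModuleCat.{u} Λ) 0).obj M)) := by
      intro i hi
      rcases lt_or_gt_of_ne hi with h | h
      · exact DerivedCategory.isZero_of_isGE _ 0 i h
      · exact DerivedCategory.isZero_of_isLE _ 0 i h
    refine ⟨⟨0, 0, fun i hi => h0 i (by omega)⟩, fun i => ?_⟩
    by_cases hi : i = 0
    · subst hi
      have : Module.Finite Λ ((𝟭 (ModuleCat.{u} Λ)).obj M) := ‹Module.Finite Λ M›
      exact Module.Finite.equiv
        ((DerivedCategory.singleFunctorCompHomologyFunctorIso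
          (ModuleCat.{u} Λ) 0).app M).toLinearEquiv.symm
    · have := ModuleCat.subsingleton_of_isZero (h0 i hi)
      infer_instance⟩

end Db

/-! ### The stable category of finitely generated modules -/

section Stable

variable (Λ : Type u) [Ring Λ]

/-- The morphism `f` of finitely generated modules factors through a (finitely generated)
projective module. -/
def FactorsThroughProjective {Λ : Type u} [Ring Λ] {X Y : FGModuleCat.{u} Λ} (f : X ⟶ Y) : Prop :=
  ∃ (P : FGModuleCat.{u} Λ) (a : X ⟶ P) (b : P ⟶ Y), Module.Projective Λ P ∧ a ≫ b = f

section

variable {Λ} {X Y Z : FGModuleCat.{u} Λ}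

lemma FactorsThroughProjective.zero : FactorsThroughProjective (0 : X ⟶ Y) :=
  ⟨FGModuleCat.of Λ PUnit.{u + 1}, 0, 0, inferInstanceAs (Module.Projective Λ PUnit.{u + 1}),
    by simp⟩

lemma FactorsThroughProjective.add {f g : X ⟶ Y} (hf : FactorsThroughProjective f)
    (hg : FactorsThroughProjective g) : FactorsThroughProjective (f + g) := by
  obtain ⟨P, a, b, hP, rfl⟩ := hf
  obtain ⟨Q, c, d, hQ, rfl⟩ := hg
  refine ⟨FGModuleCat.of Λ (P × Q), FGModuleCat.ofHom (a.hom.hom.prod c.hom.hom),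
    FGModuleCat.ofHom (b.hom.hom.coprod d.hom.hom), inferInstanceAs (Module.Projective Λ (P × Q)),
    ?_⟩
  ext x
  rfl

lemma FactorsThroughProjective.comp_left {f : X ⟶ Y} (hf : FactorsThroughProjective f)
    (g : Z ⟶ X) : FactorsThroughProjective (g ≫ f) := by
  obtain ⟨P, a, b, hP, rfl⟩ := hf
  exact ⟨P, g ≫ a, b, hP, by simp⟩

lemma FactorsThroughProjective.comp_right {f : X ⟶ Y} (hf : FactorsThroughProjective f)
    (g : Y ⟶ Z) : FactorsThroughProjective (f ≫ g) := by
  obtain ⟨P, a, b, hP, rfl⟩ := hf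
  exact ⟨P, a, b ≫ g, hP, by simp⟩

lemma FactorsThroughProjective.neg {f : X ⟶ Y} (hf : FactorsThroughProjective f) :
    FactorsThroughProjective (-f) := by
  obtain ⟨P, a, b, hP, rfl⟩ := hf
  exact ⟨P, a, -b, hP, by simp⟩

end

/-- Two morphisms are identified in the stable category if their difference factors through a
projective module. -/
def stableRel : HomRel (FGModuleCat.{u} Λ) := fun _ _ f g => FactorsThroughProjective (f - g)

instance : Congruence (stableRel Λ) where
  equivalence :=
    { refl := fun f => by
        change FactorsThroughProjective (f - f)
        rw [sub_self]
        exact .zero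
      symm := fun {f g} h => by
        change FactorsThroughProjective (g - f)
        rw [← neg_sub]
        exact h.neg
      trans := fun {f g h} h1 h2 => by
        change FactorsThroughProjective (f - h)
        rw [← sub_add_sub_cancel f g h]
        exact h1.add h2 }
  comp_left f _ _ h := by
    change FactorsThroughProjective (f ≫ _ - f ≫ _)
    rw [← Preadditive.comp_sub]
    exact h.comp_left f
  comp_right g h := by
    change FactorsThroughProjective (_ ≫ g - _ ≫ g)
    rw [← Preadditive.sub_comp]
    exact h.comp_right g

/-- The stable category of finitely generated `Λ`-modules: the morphisms are those of `mod Λ`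
modulo the morphisms that factor through projective modules. -/
abbrev StableMod := CategoryTheory.Quotient (stableRel Λ)

lemma stableRel_add ⦃X Y : FGModuleCat.{u} Λ⦄ (f₁ f₂ g₁ g₂ : X ⟶ Y) (hf : stableRel Λ f₁ f₂)
    (hg : stableRel Λ g₁ g₂) : stableRel Λ (f₁ + g₁) (f₂ + g₂) := by
  change FactorsThroughProjective _
  rw [add_sub_add_comm]
  exact hf.add hg

noncomputable instance : Preadditive (StableMod Λ) :=
  CategoryTheory.Quotient.preadditive _ (stableRel_add Λ)

instance : (CategoryTheory.Quotient.functor (stableRel Λ)).Additive :=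
  CategoryTheory.Quotient.functor_additive _ (stableRel_add Λ)

section Linear

variable (k : Type*) [CommRing k] [Algebra k Λ]

/-- The action of the scalars `k` on the modules over the `k`-algebra `Λ`, as a ring homomorphism
to the center of the category `mod Λ`. -/
noncomputable def scalarToCenter : k →+* CatCenter (FGModuleCat.{u} Λ) where
  toFun c :=
    { app := fun X => ObjectProperty.homMk (ModuleCat.ofHom
        { toFun := fun x : X.obj => algebraMap k Λ c • x
          map_add' := fun x y => smul_add _ x y
          map_smul' := fun a x => by
            rw [RingHom.id_apply, smul_smul, smul_smul, Algebra.commutes] })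
      naturality := fun X Y f => by
        ext x
        exact (map_smul f.hom.hom (algebraMap k Λ c) x).symm }
  map_one' := by
    ext X x
    exact (congrArg (· • x) (_root_.map_one (algebraMap k Λ))).trans (one_smul Λ x)
  map_mul' c d := by
    ext X x
    exact (congrArg (· • x) (_root_.map_mul (algebraMap k Λ) c d)).trans (mul_smul _ _ x)
  map_zero' := by
    ext X x
    exact (congrArg (· • x) (_root_.map_zero (algebraMap k Λ))).trans (zero_smul Λ x)
  map_add' c d := by
    ext X x
    exact (congrArg (· • x) (_root_.map_add (algebraMap k Λ) c d)).trans (add_smul _ _ x)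

/-- The stable category over a `k`-algebra is `k`-linear: `c • f` is the class of
`x ↦ c • f x`. -/
noncomputable instance : Linear k (StableMod Λ) :=
  letI : Linear k (FGModuleCat.{u} Λ) := Linear.ofRingMorphism (scalarToCenter Λ k)
  CategoryTheory.Quotient.linear k (stableRel Λ) (fun c X Y f g h => by
    change FactorsThroughProjective (c • f - c • g)
    rw [← smul_sub]
    exact h.comp_left _)

end Linear

/-! ### Suspension and syzygies -/

section Suspension

/-- A left `add Λ`-approximation of `X`: a map to a finitely generated projective module through
which every map from `X` to a finitely generated projective module factors. -/
structure LeftApprox {Λ : Type u} [Ring Λ] (X : FGModuleCat.{u} Λ) where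
  P : FGModuleCat.{u} Λ
  proj : Module.Projective Λ P
  i : X ⟶ P
  fac (Q : FGModuleCat.{u} Λ) (hQ : Module.Projective Λ Q) (f : X ⟶ Q) : ∃ g : P ⟶ Q, i ≫ g = f

/-- A presentation of `X` as a quotient of a finitely generated projective module. -/
structure ProjPres {Λ : Type u} [Ring Λ] (X : FGModuleCat.{u} Λ) where
  P : FGModuleCat.{u} Λ
  proj : Module.Projective Λ P
  p : P ⟶ X
  surj : Function.Surjective p.hom.hom

lemma isNoetherianRing_of_finite (k : Type*) [CommRing k] [IsArtinianRing k] [Algebra k Λ] [Module.Finite k Λ] :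
    IsNoetherianRing Λ :=
  isNoetherian_of_tower k (inferInstance : IsNoetherian k Λ)

variable {Λ}

lemma exists_dual_generators (k : Type*) [CommRing k] [IsArtinianRing k] [Algebra k Λ] [Module.Finite k Λ]
    (X : FGModuleCat.{u} Λ) :
    ∃ (n : ℕ) (f : Fin n → (X →ₗ[Λ] Λ)), Submodule.span k (Set.range f) = ⊤ := by
  obtain ⟨m, x, hx⟩ := Module.Finite.exists_fin (R := Λ) (M := X)
  let ev : (X →ₗ[Λ] Λ) →ₗ[k] (Fin m → Λ) :=
    { toFun := fun f j => f (x j)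
      map_add' := fun _ _ => rfl
      map_smul' := fun _ _ => rfl }
  have hev : Function.Injective ev := fun f g h => by
    refine LinearMap.ext_on hx ?_
    rintro _ ⟨j, rfl⟩
    exact congrFun h j
  have : Module.Finite k (X →ₗ[Λ] Λ) := Module.Finite.of_injective ev hev
  exact Module.Finite.exists_fin

lemma nonempty_leftApprox (k : Type*) [CommRing k] [IsArtinianRing k] [Algebra k Λ] [Module.Finite k Λ]
    (X : FGModuleCat.{u} Λ) : Nonempty (LeftApprox X) := by
  obtain ⟨n, f, hf⟩ := exists_dual_generators k X
  refine ⟨⟨FGModuleCat.of Λ (Fin n → Λ), inferInstanceAs (Module.Projective Λ (Fin n → Λ)),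
    ObjectProperty.homMk (ModuleCat.ofHom (LinearMap.pi f)), fun Q hQ h => ?_⟩⟩
  obtain ⟨m, p, hp⟩ := Module.Finite.exists_fin' Λ Q
  obtain ⟨s, hs⟩ := Module.projective_lifting_property p LinearMap.id hp
  have hc : ∀ j : Fin m, ∃ c : Fin n → k,
      ∑ i, c i • f i = (LinearMap.proj j).comp (s.comp h.hom.hom) := fun j =>
    (Submodule.mem_span_range_iff_exists_fun k).1 (hf ▸ Submodule.mem_top)
  choose c hc using hc
  refine ⟨ObjectProperty.homMk (ModuleCat.ofHom (p.comp
    (LinearMap.pi fun j => ∑ i, c j i • LinearMap.proj i))), ?_⟩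
  ext x
  change p _ = h.hom.hom x
  have h1 : p (s (h.hom.hom x)) = h.hom.hom x := LinearMap.congr_fun hs _
  rw [← h1]
  congr 1
  ext j
  have h2 := LinearMap.congr_fun (hc j) x
  simp only [LinearMap.sum_apply, LinearMap.smul_apply, LinearMap.comp_apply,
    LinearMap.proj_apply, LinearMap.pi_apply] at h2 ⊢
  exact h2

lemma nonempty_projPres (X : FGModuleCat.{u} Λ) : Nonempty (ProjPres X) := by
  obtain ⟨m, p, hp⟩ := Module.Finite.exists_fin' Λ X
  exact ⟨⟨FGModuleCat.of Λ (Fin m → Λ), inferInstanceAs (Module.Projective Λ (Fin m → Λ)),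
    ObjectProperty.homMk (ModuleCat.ofHom p), hp⟩⟩

/-- The cokernel of a left approximation. -/
def LeftApprox.coker {X : FGModuleCat.{u} Λ} (A : LeftApprox X) : FGModuleCat.{u} Λ :=
  FGModuleCat.of Λ (A.P ⧸ LinearMap.range A.i.hom.hom)

/-- The projection to the cokernel of a left approximation. -/
def LeftApprox.π {X : FGModuleCat.{u} Λ} (A : LeftApprox X) : A.P ⟶ A.coker :=
  ObjectProperty.homMk (ModuleCat.ofHom (Submodule.mkQ _))

lemma LeftApprox.i_π {X : FGModuleCat.{u} Λ} (A : LeftApprox X) : A.i ≫ A.π = 0 := by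
  ext x
  exact (Submodule.Quotient.mk_eq_zero _).2 ⟨x, rfl⟩

lemma LeftApprox.exists_desc {X Z : FGModuleCat.{u} Λ} (A : LeftApprox X) (g : A.P ⟶ Z)
    (hg : A.i ≫ g = 0) : ∃ h : A.coker ⟶ Z, A.π ≫ h = g := by
  refine ⟨ObjectProperty.homMk (ModuleCat.ofHom (Submodule.liftQ _ g.hom.hom ?_)), ?_⟩
  · rintro _ ⟨x, rfl⟩
    exact congrArg (fun f : X ⟶ Z => f.hom.hom x) hg
  · ext x
    rfl

lemma LeftApprox.π_cancel {X Z : FGModuleCat.{u} Λ} (A : LeftApprox X) {g h : A.coker ⟶ Z}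
    (e : A.π ≫ g = A.π ≫ h) : g = h := by
  ext x
  obtain ⟨y, rfl⟩ := Submodule.mkQ_surjective _ x
  exact congrArg (fun f : A.P ⟶ Z => f.hom.hom y) e

/-- The map `h` between cokernels is induced by `f`. -/
def LeftApprox.Induced {X Y : FGModuleCat.{u} Λ} (A : LeftApprox X) (B : LeftApprox Y) (f : X ⟶ Y)
    (h : A.coker ⟶ B.coker) : Prop :=
  ∃ g : A.P ⟶ B.P, A.i ≫ g = f ≫ B.i ∧ A.π ≫ h = g ≫ B.π

lemma LeftApprox.exists_induced {X Y : FGModuleCat.{u} Λ} (A : LeftApprox X) (B : LeftApprox Y)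
    (f : X ⟶ Y) : ∃ h, A.Induced B f h := by
  obtain ⟨g, hg⟩ := A.fac B.P B.proj (f ≫ B.i)
  obtain ⟨h, hh⟩ := A.exists_desc (g ≫ B.π) (by
    rw [← Category.assoc, hg, Category.assoc, B.i_π, Limits.comp_zero])
  exact ⟨h, g, hg, hh⟩

lemma LeftApprox.Induced.sub {X Y : FGModuleCat.{u} Λ} {A : LeftApprox X} {B : LeftApprox Y}
    {f f' : X ⟶ Y} {h h' : A.coker ⟶ B.coker} (H : A.Induced B f h) (H' : A.Induced B f' h') :
    A.Induced B (f - f') (h - h') := by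
  obtain ⟨g, h1, h2⟩ := H
  obtain ⟨g', h1', h2'⟩ := H'
  refine ⟨g - g', ?_, ?_⟩
  · rw [Preadditive.comp_sub, Preadditive.sub_comp, h1, h1']
  · rw [Preadditive.comp_sub, Preadditive.sub_comp, h2, h2']

lemma LeftApprox.Induced.comp {X Y Z : FGModuleCat.{u} Λ} {A : LeftApprox X} {B : LeftApprox Y}
    {C : LeftApprox Z} {f : X ⟶ Y} {f' : Y ⟶ Z} {h : A.coker ⟶ B.coker} {h' : B.coker ⟶ C.coker}
    (H : A.Induced B f h) (H' : B.Induced C f' h') : A.Induced C (f ≫ f') (h ≫ h') := by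
  obtain ⟨g, h1, h2⟩ := H
  obtain ⟨g', h1', h2'⟩ := H'
  refine ⟨g ≫ g', ?_, ?_⟩
  · rw [← Category.assoc, h1, Category.assoc, h1', Category.assoc]
  · rw [← Category.assoc, h2, Category.assoc, h2', Category.assoc]

lemma LeftApprox.Induced.factors {X Y : FGModuleCat.{u} Λ} {A : LeftApprox X} {B : LeftApprox Y}
    {f : X ⟶ Y} {h : A.coker ⟶ B.coker} (H : A.Induced B f h) (hf : FactorsThroughProjective f) :
    FactorsThroughProjective h := by
  obtain ⟨g, h1, h2⟩ := H
  obtain ⟨Q, a, b, hQ, rfl⟩ := hf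
  obtain ⟨a', rfl⟩ := A.fac Q hQ a
  obtain ⟨v, hv⟩ := A.exists_desc (g - a' ≫ b ≫ B.i) (by
    rw [Preadditive.comp_sub, h1]
    simp)
  refine ⟨B.P, v, B.π, B.proj, A.π_cancel ?_⟩
  rw [← Category.assoc, hv, Preadditive.sub_comp, h2, Category.assoc, Category.assoc, B.i_π]
  simp

lemma LeftApprox.Induced.sound {X Y : FGModuleCat.{u} Λ} {A : LeftApprox X} {B : LeftApprox Y}
    {f f' : X ⟶ Y} {h h' : A.coker ⟶ B.coker} (H : A.Induced B f h) (H' : A.Induced B f' h')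
    (hf : stableRel Λ f f') : (CategoryTheory.Quotient.functor (stableRel Λ)).map h =
      (CategoryTheory.Quotient.functor (stableRel Λ)).map h' :=
  CategoryTheory.Quotient.sound _ ((H.sub H').factors hf)

/-- A chosen left `add Λ`-approximation. -/
noncomputable def leftApprox (k : Type*) [CommRing k] [IsArtinianRing k] [Algebra k Λ] [Module.Finite k Λ]
    (X : FGModuleCat.{u} Λ) : LeftApprox X :=
  (nonempty_leftApprox k X).some

variable (Λ) in
/-- The functor `Σ` on the stable category: it sends `X` to the cokernel of a left
`add Λ`-approximation `X ⟶ P` and the class of a map to the class of any induced map between the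
cokernels. -/
noncomputable def stableSuspension (k : Type*) [CommRing k] [IsArtinianRing k] [Algebra k Λ] [Module.Finite k Λ] :
    StableMod Λ ⥤ StableMod Λ :=
  CategoryTheory.Quotient.lift (stableRel Λ)
    { obj := fun X => (CategoryTheory.Quotient.functor (stableRel Λ)).obj (leftApprox k X).coker
      map := fun {X Y} f => (CategoryTheory.Quotient.functor (stableRel Λ)).map
        ((leftApprox k X).exists_induced (leftApprox k Y) f).choose
      map_id := fun X => by
        rw [← (CategoryTheory.Quotient.functor (stableRel Λ)).map_id]
        exact ((leftApprox k X).exists_induced (leftApprox k X) (𝟙 X)).choose_spec.sound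
          ⟨𝟙 _, by simp, by simp⟩ (Congruence.equivalence.refl _)
      map_comp := fun {X Y Z} f g => by
        rw [← (CategoryTheory.Quotient.functor (stableRel Λ)).map_comp]
        exact ((leftApprox k X).exists_induced (leftApprox k Z) (f ≫ g)).choose_spec.sound
          (((leftApprox k X).exists_induced (leftApprox k Y) f).choose_spec.comp
            ((leftApprox k Y).exists_induced (leftApprox k Z) g).choose_spec)
          (Congruence.equivalence.refl _) }
    (fun X Y f f' h => ((leftApprox k X).exists_induced (leftApprox k Y) f).choose_spec.sound
      ((leftApprox k X).exists_induced (leftApprox k Y) f').choose_spec h)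

lemma ProjPres.fac {X : FGModuleCat.{u} Λ} (A : ProjPres X) (Q : FGModuleCat.{u} Λ)
    (hQ : Module.Projective Λ Q) (f : Q ⟶ X) : ∃ g : Q ⟶ A.P, g ≫ A.p = f := by
  obtain ⟨g, hg⟩ := Module.projective_lifting_property A.p.hom.hom f.hom.hom A.surj
  refine ⟨ObjectProperty.homMk (ModuleCat.ofHom g), ?_⟩
  ext x
  exact LinearMap.congr_fun hg x

variable [IsNoetherianRing Λ]

/-- The syzygy: the kernel of a projective presentation. -/
def ProjPres.ker {X : FGModuleCat.{u} Λ} (A : ProjPres X) : FGModuleCat.{u} Λ :=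
  ⟨ModuleCat.of Λ (LinearMap.ker A.p.hom.hom), by
    have : IsNoetherian Λ A.P := isNoetherian_of_isNoetherianRing_of_finite Λ A.P
    exact (inferInstance : Module.Finite Λ (LinearMap.ker A.p.hom.hom))⟩

/-- The inclusion of the syzygy. -/
def ProjPres.ι {X : FGModuleCat.{u} Λ} (A : ProjPres X) : A.ker ⟶ A.P :=
  ObjectProperty.homMk (ModuleCat.ofHom (Submodule.subtype _))

lemma ProjPres.ι_p {X : FGModuleCat.{u} Λ} (A : ProjPres X) : A.ι ≫ A.p = 0 := by
  ext x
  exact x.2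

lemma ProjPres.exists_lift {X Z : FGModuleCat.{u} Λ} (A : ProjPres X) (g : Z ⟶ A.P)
    (hg : g ≫ A.p = 0) : ∃ h : Z ⟶ A.ker, h ≫ A.ι = g :=
  ⟨ObjectProperty.homMk (ModuleCat.ofHom (LinearMap.codRestrict _ g.hom.hom
    (fun x => congrArg (fun f : Z ⟶ X => f.hom.hom x) hg))), rfl⟩

lemma ProjPres.ι_cancel {X Z : FGModuleCat.{u} Λ} (A : ProjPres X) {g h : Z ⟶ A.ker}
    (e : g ≫ A.ι = h ≫ A.ι) : g = h := by
  ext x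
  exact Subtype.ext (congrArg (fun f : Z ⟶ A.P => f.hom.hom x) e)

/-- The map `h` between syzygies is induced by `f`. -/
def ProjPres.Induced {X Y : FGModuleCat.{u} Λ} (A : ProjPres X) (B : ProjPres Y) (f : X ⟶ Y)
    (h : A.ker ⟶ B.ker) : Prop :=
  ∃ g : A.P ⟶ B.P, g ≫ B.p = A.p ≫ f ∧ h ≫ B.ι = A.ι ≫ g

lemma ProjPres.exists_induced {X Y : FGModuleCat.{u} Λ} (A : ProjPres X) (B : ProjPres Y)
    (f : X ⟶ Y) : ∃ h, A.Induced B f h := by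
  obtain ⟨g, hg⟩ := B.fac A.P A.proj (A.p ≫ f)
  obtain ⟨h, hh⟩ := B.exists_lift (A.ι ≫ g) (by
    rw [Category.assoc, hg, ← Category.assoc, A.ι_p, Limits.zero_comp])
  exact ⟨h, g, hg, hh⟩

lemma ProjPres.Induced.sub {X Y : FGModuleCat.{u} Λ} {A : ProjPres X} {B : ProjPres Y}
    {f f' : X ⟶ Y} {h h' : A.ker ⟶ B.ker} (H : A.Induced B f h) (H' : A.Induced B f' h') :
    A.Induced B (f - f') (h - h') := by
  obtain ⟨g, h1, h2⟩ := H
  obtain ⟨g', h1', h2'⟩ := H'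
  refine ⟨g - g', ?_, ?_⟩
  · rw [Preadditive.comp_sub, Preadditive.sub_comp, h1, h1']
  · rw [Preadditive.comp_sub, Preadditive.sub_comp, h2, h2']

lemma ProjPres.Induced.comp {X Y Z : FGModuleCat.{u} Λ} {A : ProjPres X} {B : ProjPres Y}
    {C : ProjPres Z} {f : X ⟶ Y} {f' : Y ⟶ Z} {h : A.ker ⟶ B.ker} {h' : B.ker ⟶ C.ker}
    (H : A.Induced B f h) (H' : B.Induced C f' h') : A.Induced C (f ≫ f') (h ≫ h') := by
  obtain ⟨g, h1, h2⟩ := H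
  obtain ⟨g', h1', h2'⟩ := H'
  refine ⟨g ≫ g', ?_, ?_⟩
  · rw [Category.assoc, h1', ← Category.assoc, h1, Category.assoc]
  · rw [Category.assoc, h2', ← Category.assoc, h2, Category.assoc]

lemma ProjPres.Induced.factors {X Y : FGModuleCat.{u} Λ} {A : ProjPres X} {B : ProjPres Y}
    {f : X ⟶ Y} {h : A.ker ⟶ B.ker} (H : A.Induced B f h)
    (hf : FactorsThroughProjective f) : FactorsThroughProjective h := by
  obtain ⟨g, h1, h2⟩ := H
  obtain ⟨Q, a, b, hQ, rfl⟩ := hf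
  obtain ⟨b', rfl⟩ := B.fac Q hQ b
  obtain ⟨v, hv⟩ := B.exists_lift (g - A.p ≫ a ≫ b') (by
    rw [Preadditive.sub_comp, h1]
    simp)
  refine ⟨A.P, A.ι, v, A.proj, B.ι_cancel ?_⟩
  rw [Category.assoc, hv, Preadditive.comp_sub, h2, ← Category.assoc (A.ι) A.p, A.ι_p]
  simp

lemma ProjPres.Induced.sound {X Y : FGModuleCat.{u} Λ} {A : ProjPres X} {B : ProjPres Y}
    {f f' : X ⟶ Y} {h h' : A.ker ⟶ B.ker} (H : A.Induced B f h) (H' : A.Induced B f' h')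
    (hf : stableRel Λ f f') : (CategoryTheory.Quotient.functor (stableRel Λ)).map h =
      (CategoryTheory.Quotient.functor (stableRel Λ)).map h' :=
  CategoryTheory.Quotient.sound _ ((H.sub H').factors hf)

/-- A chosen projective presentation. -/
noncomputable def projPres (X : FGModuleCat.{u} Λ) : ProjPres X :=
  (nonempty_projPres X).some

variable (Λ) in
/-- The syzygy functor `Ω` on the stable category: it sends `X` to the kernel of a surjection
`P ⟶ X` with `P` projective, and the class of a map to the class of any induced map between the
kernels. -/
noncomputable def stableSyzygy : StableMod Λ ⥤ StableMod Λ :=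
  CategoryTheory.Quotient.lift (stableRel Λ)
    { obj := fun X => (CategoryTheory.Quotient.functor (stableRel Λ)).obj ((projPres X).ker)
      map := fun {X Y} f => (CategoryTheory.Quotient.functor (stableRel Λ)).map
        ((projPres X).exists_induced (projPres Y) f).choose
      map_id := fun X => by
        rw [← (CategoryTheory.Quotient.functor (stableRel Λ)).map_id]
        exact ((projPres X).exists_induced (projPres X) (𝟙 X)).choose_spec.sound
          ⟨𝟙 _, by simp, by simp⟩ (Congruence.equivalence.refl _)
      map_comp := fun {X Y Z} f g => by
        rw [← (CategoryTheory.Quotient.functor (stableRel Λ)).map_comp]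
        exact ((projPres X).exists_induced (projPres Z) (f ≫ g)).choose_spec.sound
          (((projPres X).exists_induced (projPres Y) f).choose_spec.comp
            ((projPres Y).exists_induced (projPres Z) g).choose_spec)
          (Congruence.equivalence.refl _) }
    (fun X Y f f' h => ((projPres X).exists_induced (projPres Y) f).choose_spec.sound
      ((projPres X).exists_induced (projPres Y) f').choose_spec h)

end Suspension

/-- The `n`-fold composite of an endofunctor. -/
def functorPow {C : Type*} [Category C] (F : C ⥤ C) : ℕ → (C ⥤ C)
  | 0 => 𝟭 C
  | n + 1 => functorPow F n ⋙ F

/-- `Σᵈ` for `d ∈ ℤ`; the negative powers are the powers of `Ω`, which is inverse to `Σ` on maximal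
Cohen-Macaulay modules over a Gorenstein algebra. -/
noncomputable def stableShift (k : Type*) [CommRing k] [IsArtinianRing k] [Algebra k Λ] [Module.Finite k Λ] :
    ℤ → (StableMod Λ ⥤ StableMod Λ)
  | Int.ofNat n => functorPow (stableSuspension Λ k) n
  | Int.negSucc n =>
    haveI := isNoetherianRing_of_finite Λ k
    functorPow (stableSyzygy Λ) (n + 1)

/-! ### Maximal Cohen-Macaulay modules and stably symmetric algebras -/

/-- Maximal Cohen-Macaulay modules, as objects of the stable category of finitely generated
modules: `Extⁱ(M, Λ) = 0` for all `i > 0`. -/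
def isMCM : ObjectProperty (StableMod Λ) := fun M =>
  ∀ i : ℕ, 0 < i → Subsingleton (Ext.{u} M.as.obj (ModuleCat.of Λ Λ) i)

/-- The stable category of maximal Cohen-Macaulay `Λ`-modules. -/
abbrev StableMCM := (isMCM Λ).FullSubcategory

/-- A Serre functor on a `k`-linear category `T`, for the duality `D = Hom_k(-, E)`: a `k`-linear
equivalence `S` with `k`-linear isomorphisms `Hom(X, Y) ≃ D Hom(Y, S X)` that are functorial in
`X` and `Y`. -/
structure SerreFunctor (k : Type*) [CommRing k] (E : Type*) [AddCommGroup E] [Module k E]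
    (T : Type*) [Category T] [Preadditive T] [Linear k T] where
  S : T ⥤ T
  additive : S.Additive
  linear : S.Linear k
  isEquivalence : S.IsEquivalence
  duality (X Y : T) : (X ⟶ Y) ≃ₗ[k] ((Y ⟶ S.obj X) →ₗ[k] E)
  natural_left {X' X Y : T} (a : X' ⟶ X) (f : X ⟶ Y) (h : Y ⟶ S.obj X') :
    duality X' Y (a ≫ f) h = duality X Y f (h ≫ S.map a)
  natural_right {X Y Y' : T} (f : X ⟶ Y) (b : Y ⟶ Y') (h : Y' ⟶ S.obj X) :
    duality X Y' (f ≫ b) h = duality X Y f (b ≫ h)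

/-- `Λ` is stably symmetric: the stable category of maximal Cohen-Macaulay modules is weakly
`d`-Calabi-Yau for some `d ∈ ℤ`, that is, it has a Serre functor isomorphic to `Σᵈ`. -/
def IsStablySymmetric (k : Type*) [CommRing k] [IsArtinianRing k] [Algebra k Λ]
    [Module.Finite k Λ] (E : Type*) [AddCommGroup E] [Module k E] : Prop :=
  ∃ (d : ℤ) (F : SerreFunctor k E (StableMCM Λ)),
    Nonempty (F.S ⋙ (isMCM Λ).ι ≅ (isMCM Λ).ι ⋙ stableShift Λ k d)

end Stable

/-! ### Even elements of the graded center -/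

/-! The proof combines finiteness of `id Λ`, a gap theorem giving a uniform bound for vanishing, and
Serre duality on the stable category.

Finiteness of `id Λ`: by dévissage, `Ext*(M, N)` is eventually Noetherian over `R` for all finitely
generated `M`, `N`. The action on `Ext*(-, Λ)` goes through the target, and positive degree elements
act on `Λ` through `Ext^{>0}(Λ, Λ) = 0`. So finitely many generators only reach bounded degrees, and
`Extⁱ(M, Λ) = 0` for large `i`, uniformly in `M` (`exists_subsingleton_ext_self`).

Gap theorem (`subsingleton_ext_of_eventually`): even elements of `R` are central and commute with
all morphisms. An even `r` of degree `n` has a cone `X → ΣⁿX → K` on which `r²` is zero. Coning off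
finitely many elements makes every even element of positive degree nilpotent, and then `Hom(K,
Σⁱ(Λ/𝔯)) = 0` for `i ≫ 0` (`cone_induction`). Such a `K` behaves like an object of finite projective
dimension: vanishing of `Hom(K, ΣⁱΛ)` for `i > a` spreads to every `N` through free presentations.
Going back from `K` to `X`, multiplication by `r` is injective on `Hom(X, ΣⁱN)` for `i > a`, so
eventual vanishing becomes vanishing for all `i > a`.

Symmetry (`eventually_ext_symm`): let `Extⁱ(-, Λ)` vanish for `i ≥ d`, so that `d`-th syzygies are
maximal Cohen-Macaulay. If `Extⁱ(M, N) = 0` for `i ≫ 0`, the same holds for every `ΩʲN`, and the gap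
theorem gives vanishing in degree `d + 1` for all `j` at once. Hence there are no nonzero stable
maps from `Ωᵈ⁺¹M` to any `ΩʲΩᵈN`. On sufficiently high syzygies the Serre functor again produces
syzygies, so duality kills the stable maps from high syzygies of `N` to `Ωᵈ⁺¹M`. These control the
high groups `Extⁱ(N, Ωᵈ⁺¹M)`, hence `Extⁱ(N, M)`. -/

lemma ShiftedHom.precomp_comp {T : Type*} [Category T] [HasShift T ℤ]
    {X Y Z W : T} {a b c : ℤ} (p : X ⟶ Y) (f : ShiftedHom Y Z a)
    (g : ShiftedHom Z W b) (h : b + a = c) :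
    ShiftedHom.comp (X := X) (Y := Z) (p ≫ f) g h = p ≫ f.comp g h := by
  simp only [ShiftedHom.comp, Category.assoc]

section GradedCenter

variable {T : Type*} [Category T] [Preadditive T] [HasShift T ℤ]
  [∀ n : ℤ, (shiftFunctor T n).Additive]

/-- The canonical commutation of `Σⁿ` with the shifts, without signs. -/
noncomputable abbrev shiftFunctorCommShift (n : ℤ) : (shiftFunctor T n).CommShift ℤ where
  commShiftIso m := shiftFunctorComm T m n
  commShiftIso_zero := by
    ext X
    rw [← shiftFunctorComm_symm, Iso.symm_hom, ← cancel_mono ((shiftFunctorComm T n 0).hom.app X),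
      Iso.inv_hom_id_app, shiftFunctorComm_zero_hom_app]
    simp [← Functor.map_comp]
  commShiftIso_add a b := by
    ext X
    have h := shiftFunctorComm_hom_app_comp_shift_shiftFunctorAdd_hom_app n a b X
    rw [← shiftFunctorComm_symm, Iso.symm_hom,
      ← cancel_mono ((shiftFunctorComm T n (a + b)).hom.app X), Iso.inv_hom_id_app,
      ← cancel_mono (((shiftFunctorAdd T a b).hom.app X)⟦n⟧'), Category.assoc, h]
    simp only [Functor.CommShift.isoAdd_hom_app, Category.assoc]
    rw [← shiftFunctorComm_symm T n a, ← shiftFunctorComm_symm T n b]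
    simp [← Functor.map_comp_assoc]

/-- For even `n` the sign in the graded center disappears, so `f` is compatible with `Σ` through the
unsigned commutation of shifts. This compatibility is additive in the shift and therefore holds for
`Σᵐ`. -/
lemma centerApp_shift {n : ℤ} (hn : Even n) (f : gradedCenter T n) (m : ℕ) (X : T) :
    centerApp f (X⟦(m : ℤ)⟧) = (centerApp f X)⟦(m : ℤ)⟧' ≫ (shiftFunctorComm T n m).hom.app X := by
  let inst := shiftFunctorCommShift (T := T) n
  have hc (a : ℤ) : Functor.commShiftIso (shiftFunctor T n) a = (shiftFunctorComm T n a).symm :=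
    (shiftFunctorComm_symm T n a).symm
  have h1 : NatTrans.CommShiftCore f.1 (1 : ℤ) := ⟨by
    ext X
    have := f.2 X
    rw [Int.negOnePow_even n hn, one_smul] at this
    dsimp at this ⊢
    rw [this, hc]
    simp⟩
  have hm : NatTrans.CommShiftCore f.1 (m : ℤ) := by
    induction m with
    | zero => exact .zero _
    | succ m ih => rw [Nat.cast_succ]; exact ih.add h1
  rw [centerApp, hm.app_shift, hc]
  simp

lemma centerApp_comp_map {n : ℤ} (f : gradedCenter T n) {X Y : T} (g : X ⟶ Y) :
    g ≫ centerApp f Y = centerApp f X ≫ g⟦n⟧' :=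
  f.1.naturality g

/-- Elements of the graded center of even degree commute with all morphisms. -/
lemma ShiftedHom.comp_centerApp {n : ℤ} (hn : Even n) (f : gradedCenter T n) {X Y : T} {m : ℕ}
    (g : ShiftedHom X Y (m : ℤ)) {c : ℤ} (h : n + m = c) :
    g.comp (centerApp f Y) h = (centerApp f X).comp g (by rw [← h, add_comm]) := by
  have h1 := centerApp_shift hn f m Y
  have h2 := centerApp_comp_map f g
  rw [h1] at h2
  simp only [ShiftedHom.comp]
  rw [← reassoc_of% h2, shiftFunctorComm_eq T n m c h]
  simp

end GradedCenter

/-! ### Even elements acting trivially on an object, and their behaviour in triangles. -/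

namespace CentralAction

variable {R : Type*} [Ring R] {T : Type*} [Category T] [Preadditive T] [HasShift T ℤ]
  [∀ n : ℤ, (shiftFunctor T n).Additive] {𝒜 : ℕ → AddSubgroup R} [GradedRing 𝒜]
  (act : CentralAction T 𝒜)

/-- `z` is homogeneous of even degree and acts trivially on `X`. -/
def EvenKills (z : R) (X : T) : Prop :=
  ∃ (n : ℕ) (_ : Even n) (h : z ∈ 𝒜 n), centerApp (act.toCenter n ⟨z, h⟩) X = 0

variable {act}

lemma EvenKills.shift {z : R} {X : T} (h : act.EvenKills z X) (m : ℕ) :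
    act.EvenKills z (X⟦(m : ℤ)⟧) := by
  obtain ⟨n, hn, hz, h0⟩ := h
  refine ⟨n, hn, hz, ?_⟩
  rw [centerApp_shift ((Int.even_coe_nat n).2 hn), h0, Functor.map_zero, Limits.zero_comp]

variable [Limits.HasZeroObject T] [Pretriangulated T]

open Pretriangulated

/-- Since `z` vanishes on the first object, its component at the middle one factors through the
third. Being even, `y` can be moved across that factor to the third object, where it is zero. -/
lemma EvenKills.mul_of_distTriang {y z : R} {D : Triangle T} (hD : D ∈ distTriang T)
    (hy : act.EvenKills y D.obj₃) (hz : act.EvenKills z D.obj₁) :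
    act.EvenKills (y * z) D.obj₂ := by
  obtain ⟨m, hm, hym, hy0⟩ := hy
  obtain ⟨n, hn, hzn, hz0⟩ := hz
  refine ⟨m + n, hm.add hn, SetLike.GradedMul.mul_mem hym hzn, ?_⟩
  rw [act.map_mul ⟨y, hym⟩ ⟨z, hzn⟩]
  have h1 : D.mor₁ ≫ centerApp (act.toCenter n ⟨z, hzn⟩) D.obj₂ = 0 := by
    rw [centerApp_comp_map, hz0, Limits.zero_comp]
  obtain ⟨g, hg⟩ := Triangle.yoneda_exact₂ D hD _ h1
  have h2 := ShiftedHom.comp_centerApp ((Int.even_coe_nat m).2 hm) (act.toCenter m ⟨y, hym⟩)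
    (X := D.obj₃) (Y := D.obj₂) (m := n) g (Nat.cast_add m n).symm
  rw [hy0, ShiftedHom.zero_comp] at h2
  rw [hg, ShiftedHom.precomp_comp, h2, Limits.comp_zero]

/-- The component `r_K` vanishes after `j`, because `j ≫ r_K = Σⁿ(r_X ≫ j)`, so `r_K = p ≫ g`.
Multiplying by `r` once more and moving it to the source of `g` gives a map starting with `p ≫
Σ(r_X) = 0`. -/
lemma evenKills_mul_self_of_distTriang {n : ℕ} (hn : Even n) (r : 𝒜 n) {X K : T}
    {j : X⟦(n : ℤ)⟧ ⟶ K} {p : K ⟶ X⟦(1 : ℤ)⟧}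
    (hD : Triangle.mk (centerApp (act.toCenter n r) X) j p ∈ distTriang T) :
    act.EvenKills (r.1 * r.1) K := by
  have hn' : Even (n : ℤ) := (Int.even_coe_nat n).2 hn
  refine ⟨n + n, hn.add hn, SetLike.GradedMul.mul_mem r.2 r.2, ?_⟩
  rw [act.map_mul r r]
  have h1 : j ≫ centerApp (act.toCenter n r) K = 0 := by
    have h12 : centerApp (act.toCenter n r) X ≫ j = 0 := comp_distTriang_mor_zero₁₂ _ hD
    rw [centerApp_comp_map, centerApp_shift hn', shiftFunctorComm_eq_refl]
    simp only [Iso.refl_hom, NatTrans.id_app]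
    erw [Category.comp_id]
    rw [← Functor.map_comp, h12, Functor.map_zero]
  obtain ⟨g, hg⟩ : ∃ g, centerApp (act.toCenter n r) K = p ≫ g :=
    Triangle.yoneda_exact₃ _ hD _ h1
  have h2 := ShiftedHom.comp_centerApp hn' (act.toCenter n r)
    (X := X⟦(1 : ℤ)⟧) (Y := K) (m := n) g (Nat.cast_add n n).symm
  have h3 : p ≫ centerApp (act.toCenter n r) (X⟦(1 : ℤ)⟧) = 0 := by
    have h31 : p ≫ (centerApp (act.toCenter n r) X)⟦(1 : ℤ)⟧' = 0 :=
      comp_distTriang_mor_zero₃₁ _ hD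
    have h := centerApp_shift hn' (act.toCenter n r) 1 X
    rw [Nat.cast_one] at h
    rw [h, reassoc_of% h31, Limits.zero_comp]
  have h4 := ShiftedHom.precomp_comp p (Z := K) (a := (n : ℤ)) g
    (centerApp (act.toCenter n r) K) (Nat.cast_add n n).symm
  rw [← hg] at h4
  rw [h4, h2, ShiftedHom.comp, reassoc_of% h3, Limits.zero_comp]

end CentralAction

/-- Extensions of Noetherian modules are Noetherian. This form fits the truncations `Hom^{≥ n}`,
which are submodules of the terms of a long exact sequence. -/
lemma isNoetherian_of_exact_submodules {R A B C : Type*} [Ring R] [AddCommGroup A] [AddCommGroup B]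
    [AddCommGroup C] [Module R A] [Module R B] [Module R C] (φ : A →ₗ[R] B) (ψ : B →ₗ[R] C)
    (hψφ : ∀ a, ψ (φ a) = 0) {p : Submodule R A} {q : Submodule R B} {t : Submodule R C}
    [IsNoetherian R p] [IsNoetherian R t] (hφ : ∀ a ∈ p, φ a ∈ q) (hψ : ∀ b ∈ q, ψ b ∈ t)
    (hex : ∀ b ∈ q, ψ b = 0 → ∃ a ∈ p, φ a = b) : IsNoetherian R q := by
  refine isNoetherian_of_range_eq_ker (φ.restrict hφ) (ψ.restrict hψ) ?_
  ext ⟨b, hb⟩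
  simp only [LinearMap.mem_range, LinearMap.mem_ker, Subtype.ext_iff, LinearMap.restrict_apply,
    Subtype.exists, ZeroMemClass.coe_zero]
  constructor
  · rintro ⟨a, ha, rfl⟩
    exact hψφ a
  · intro h
    obtain ⟨a, ha, rfl⟩ := hex b hb h
    exact ⟨a, ha, rfl⟩

/-- The identity of `ΣᵐX`, as a morphism of degree `m` to `X`, has a right inverse of
degree `-m`. -/
lemma ShiftedHom.exists_comp_eq_id {T : Type*} [Category T] [HasShift T ℤ] (X : T) (m : ℤ) :
    ∃ (σ : ShiftedHom (X⟦m⟧) X m) (τ : ShiftedHom X (X⟦m⟧) (-m)),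
      σ.comp τ (neg_add_cancel m) = ShiftedHom.mk₀ 0 rfl (𝟙 _) := by
  refine ⟨𝟙 _, (shiftShiftNeg X m).inv, ?_⟩
  simp only [ShiftedHom.comp, ShiftedHom.mk₀, Category.id_comp]
  change ((shiftFunctorCompIsoId T m (-m) (add_neg_cancel m)).inv.app X)⟦m⟧' ≫ _ = _
  rw [shift_shiftFunctorCompIsoId_inv_app]
  simp [shiftFunctorCompIsoId, shiftFunctorZero']

/-! ### Graded Hom groups as modules over `R`. -/

namespace CentralAction

variable {R : Type*} [Ring R] {T : Type*} [Category T] [Preadditive T] [HasShift T ℤ]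
  [∀ n : ℤ, (shiftFunctor T n).Additive] {𝒜 : ℕ → AddSubgroup R} [GradedRing 𝒜]
  (act : CentralAction T 𝒜)

section HomStar

variable {X Y : T}

namespace HomStar

/-- A homogeneous element of `Hom*(X, Y)`. -/
noncomputable def of (i : ℤ) (g : ShiftedHom X Y i) : act.HomStar X Y :=
  DirectSum.of (fun i : ℤ => ShiftedHom X Y i) i g

variable {act}

@[simp] lemma coeff_zero (i : ℤ) : (0 : act.HomStar X Y).coeff act i = 0 := rfl

@[simp] lemma coeff_add (x y : act.HomStar X Y) (i : ℤ) :
    (x + y).coeff act i = x.coeff act i + y.coeff act i := rfl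

@[ext] lemma ext_coeff {x y : act.HomStar X Y} (h : ∀ i, x.coeff act i = y.coeff act i) : x = y :=
  DFinsupp.ext h

variable (X Y) in
/-- The coefficient of degree `i`, as an additive map. -/
def coeffHom (i : ℤ) : act.HomStar X Y →+ ShiftedHom X Y i where
  toFun x := x.coeff act i
  map_zero' := rfl
  map_add' _ _ := rfl

lemma coeff_sum {ι : Type*} (s : Finset ι) (x : ι → act.HomStar X Y) (i : ℤ) :
    (∑ j ∈ s, x j).coeff act i = ∑ j ∈ s, (x j).coeff act i :=
  map_sum (coeffHom X Y i) x s

@[simp] lemma coeff_of_same (i : ℤ) (g : ShiftedHom X Y i) : (of act i g).coeff act i = g :=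
  DirectSum.of_eq_same _ _

lemma coeff_of_ne {i j : ℤ} (g : ShiftedHom X Y i) (h : j ≠ i) : (of act i g).coeff act j = 0 :=
  DirectSum.of_eq_of_ne _ _ _ h

lemma induction_of {motive : act.HomStar X Y → Prop} (x : act.HomStar X Y) (zero : motive 0)
    (of : ∀ i g, motive (of act i g)) (add : ∀ x y, motive x → motive y → motive (x + y)) :
    motive x :=
  DirectSum.induction_on (motive := motive) x zero of add

/-- A family chosen degree by degree is an element of the direct sum once its support is finite; the
support of `x` serves as the bound. -/
lemma exists_coeff_eq {X' Y' : T} (x : act.HomStar X Y) (y : ∀ i : ℤ, ShiftedHom X' Y' i)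
    (hy : ∀ i, x.coeff act i = 0 → y i = 0) : ∃ y' : act.HomStar X' Y', ∀ i, y'.coeff act i = y i := by
  classical
  refine ⟨DFinsupp.mapRange (fun i (z : ShiftedHom X Y i) => if z = 0 then 0 else y i)
    (fun i => if_pos rfl) (show Π₀ i : ℤ, ShiftedHom X Y i from x), fun i => ?_⟩
  change (DFinsupp.mapRange _ _ _ : Π₀ i : ℤ, ShiftedHom X' Y' i) i = _
  rw [DFinsupp.mapRange_apply]
  split_ifs with h
  · exact (hy i h).symm
  · rfl

lemma smul_of {n : ℕ} (r : 𝒜 n) {i j : ℤ} (g : ShiftedHom X Y i) (h : (n : ℤ) + i = j) :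
    r.1 • of act i g = of act j (g.comp (centerApp (act.toCenter n r) Y) h) := by
  ext l
  by_cases hl : l = j
  · subst hl
    rw [coeff_smul act n r _ h, coeff_of_same, coeff_of_same]
  · rw [coeff_smul act n r _ (show (n : ℤ) + (l - n) = l by ring), coeff_of_ne _ hl,
      coeff_of_ne _ (by omega), ShiftedHom.zero_comp]

/-- The coefficients of the translate of a homogeneous element. -/
lemma coeff_smul_of (r : R) {i : ℤ} (n : ℕ) (g : ShiftedHom X Y i) :
    (r • of act i g).coeff act (n + i) =
      (((DirectSum.decompose 𝒜 r n : 𝒜 n) : R) • of act i g).coeff act (n + i) := by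
  induction r using DirectSum.Decomposition.inductionOn 𝒜 with
  | zero => simp
  | @homogeneous m r =>
    by_cases hm : m = n
    · subst hm
      rw [DirectSum.decompose_coe, DirectSum.of_eq_same]
    · rw [DirectSum.decompose_coe, DirectSum.of_eq_of_ne _ _ _ (Ne.symm hm), smul_of r g rfl,
        coeff_of_ne _ (by omega)]
      simp
  | add r s hr hs =>
    simp only [DirectSum.decompose_add, DirectSum.add_apply, AddSubgroup.coe_add, add_smul,
      coeff_add, hr, hs]

end HomStar

open HomStar

lemma homGE_mono {a b : ℤ} (h : a ≤ b) : act.homGE X Y b ≤ act.homGE X Y a :=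
  fun _ hx i hi => hx i (by omega)

lemma of_mem_homGE {n i : ℤ} (h : n ≤ i) (g : ShiftedHom X Y i) :
    HomStar.of act i g ∈ act.homGE X Y n :=
  fun _ hj => coeff_of_ne g (by omega)

/-- Two additive maps on `Hom*` that commute with homogeneous elements commute with `R`. -/
lemma map_smul_of_homogeneous {X' Y' : T} (φ : act.HomStar X Y →+ act.HomStar X' Y')
    (h : ∀ (n : ℕ) (r : 𝒜 n) (x : act.HomStar X Y), φ (r.1 • x) = r.1 • φ x) (r : R)
    (x : act.HomStar X Y) : φ (r • x) = r • φ x := by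
  induction r using DirectSum.Decomposition.inductionOn 𝒜 with
  | zero => simp
  | @homogeneous n r => exact h n r x
  | add r s hr hs => rw [add_smul, map_add, hr, hs, add_smul]

/-- Precomposition with `α : X' ⟶ ΣᵐX`, as an additive map. -/
noncomputable def precompAdd {X' : T} {m : ℤ} (α : ShiftedHom X' X m) :
    act.HomStar X Y →+ act.HomStar X' Y :=
  DirectSum.toAddMonoid fun i =>
    (DirectSum.of (fun i : ℤ => ShiftedHom X' Y i) (i + m)).comp
      (AddMonoidHom.mk' (fun g : ShiftedHom X Y i => α.comp g rfl)
        (fun g h => ShiftedHom.comp_add α g h rfl))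

lemma coeff_precompAdd {X' : T} {m : ℤ} (α : ShiftedHom X' X m) (x : act.HomStar X Y) {i j : ℤ}
    (h : i + m = j) : (act.precompAdd α x).coeff act j = α.comp (x.coeff act i) h := by
  induction x using induction_of with
  | zero => rw [map_zero]; simp
  | of l g =>
    have h1 : act.precompAdd α (HomStar.of act l g) = HomStar.of act (l + m) (α.comp g rfl) :=
      toAddMonoid_of _ _ _
    rw [h1]
    by_cases hl : i = l
    · subst hl
      subst h
      simp
    · rw [coeff_of_ne _ (by omega), coeff_of_ne _ hl, ShiftedHom.comp_zero]
  | add x y hx hy => rw [map_add, coeff_add, coeff_add, hx, hy, ShiftedHom.comp_add]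

/-- Precomposition with `α : X' ⟶ ΣᵐX` is `R`-linear. -/
noncomputable def precomp {X' : T} {m : ℤ} (α : ShiftedHom X' X m) :
    act.HomStar X Y →ₗ[R] act.HomStar X' Y where
  __ := act.precompAdd α
  map_smul' := act.map_smul_of_homogeneous (act.precompAdd α) fun n r x => by
    ext j
    rw [act.coeff_precompAdd α _ (show (j - m) + m = j by ring),
      coeff_smul act n r x (show (n : ℤ) + (j - m - n) = j - m by ring),
      coeff_smul act n r _ (show (n : ℤ) + (j - n) = j by ring),
      act.coeff_precompAdd α _ (show (j - m - n) + m = j - n by ring),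
      ShiftedHom.comp_assoc _ _ _ _ _ (by ring)]

lemma coeff_precomp {X' : T} {m : ℤ} (α : ShiftedHom X' X m) (x : act.HomStar X Y) {i j : ℤ}
    (h : i + m = j) : (act.precomp α x).coeff act j = α.comp (x.coeff act i) h :=
  act.coeff_precompAdd α x h

/-- Precomposition with a morphism. -/
noncomputable abbrev precompHom {X' : T} (f : X' ⟶ X) : act.HomStar X Y →ₗ[R] act.HomStar X' Y :=
  act.precomp (ShiftedHom.mk₀ (0 : ℤ) rfl f)

@[simp] lemma coeff_precompHom {X' : T} (f : X' ⟶ X) (x : act.HomStar X Y) (i : ℤ) :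
    (act.precompHom f x).coeff act i = f ≫ x.coeff act i := by
  rw [coeff_precomp act _ x (add_zero i), ShiftedHom.mk₀_comp]

lemma precomp_mem_homGE {X' : T} {m n c : ℤ} (α : ShiftedHom X' X m) (h : n + m = c)
    {x : act.HomStar X Y} (hx : x ∈ act.homGE X Y n) : act.precomp α x ∈ act.homGE X' Y c := by
  intro j hj
  rw [act.coeff_precomp α x (show j - m + m = j by ring), hx _ (by omega), ShiftedHom.comp_zero]

/-- Postcomposition with a morphism, as an additive map. -/
noncomputable def postcompAdd {Y' : T} (f : Y ⟶ Y') : act.HomStar X Y →+ act.HomStar X Y' :=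
  DirectSum.map fun i => AddMonoidHom.mk' (fun g : ShiftedHom X Y i => (g ≫ f⟦i⟧' : ShiftedHom X Y' i))
    (fun _ _ => Preadditive.add_comp _ _ _ _ _ _)

lemma coeff_postcompAdd {Y' : T} (f : Y ⟶ Y') (x : act.HomStar X Y) (i : ℤ) :
    (act.postcompAdd f x).coeff act i = x.coeff act i ≫ f⟦i⟧' :=
  DirectSum.map_apply _ _ _

/-- Postcomposition with a morphism is `R`-linear. -/
noncomputable def postcompHom {Y' : T} (f : Y ⟶ Y') :
    act.HomStar X Y →ₗ[R] act.HomStar X Y' where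
  __ := act.postcompAdd f
  map_smul' := act.map_smul_of_homogeneous (act.postcompAdd f) fun n r x => by
    ext j
    rw [coeff_postcompAdd, coeff_smul act n r x (show (n : ℤ) + (j - n) = j by ring),
      coeff_smul act n r _ (show (n : ℤ) + (j - n) = j by ring), coeff_postcompAdd]
    simp only [ShiftedHom.comp, Category.assoc]
    rw [← Functor.map_comp_assoc, centerApp_comp_map, Functor.map_comp_assoc]
    erw [← NatTrans.naturality]
    rfl

@[simp] lemma coeff_postcompHom {Y' : T} (f : Y ⟶ Y') (x : act.HomStar X Y) (i : ℤ) :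
    (act.postcompHom f x).coeff act i = x.coeff act i ≫ f⟦i⟧' :=
  act.coeff_postcompAdd f x i

end HomStar

/-! ### Eventually Noetherian graded Hom groups -/

/-- `Hom^{≥ n}(X, Y)` is Noetherian over `R` for some `n`. -/
def EventuallyNoetherian (X Y : T) : Prop := ∃ n : ℤ, IsNoetherian R (act.homGE X Y n)

variable {act}

lemma EventuallyNoetherian.exists_ge {X Y : T} (h : act.EventuallyNoetherian X Y) :
    ∃ n : ℤ, ∀ m ≥ n, IsNoetherian R (act.homGE X Y m) := by
  obtain ⟨n, hn⟩ := h
  exact ⟨n, fun m hm => isNoetherian_of_le (act.homGE_mono hm)⟩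

lemma EventuallyNoetherian.of_retract_left {X X' Y : T} (h : act.EventuallyNoetherian X Y)
    (r : Retract X' X) : act.EventuallyNoetherian X' Y := by
  obtain ⟨n, hn⟩ := h
  refine ⟨n, isNoetherian_of_injective ((act.precompHom r.r).restrict fun x hx =>
    act.precomp_mem_homGE _ (add_zero n) hx) fun x y hxy => Subtype.ext (HomStar.ext_coeff fun i => ?_)⟩
  have h1 : (act.precompHom r.r x.1).coeff act i = (act.precompHom r.r y.1).coeff act i :=
    congrArg (fun z => HomStar.coeff act z.1 i) hxy
  rw [coeff_precompHom, coeff_precompHom] at h1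
  rw [← Category.id_comp (x.1.coeff act i), ← Category.id_comp (y.1.coeff act i), ← r.retract,
    Category.assoc, Category.assoc, h1]

lemma EventuallyNoetherian.of_retract_right {X Y Y' : T} (h : act.EventuallyNoetherian X Y)
    (r : Retract Y' Y) : act.EventuallyNoetherian X Y' := by
  obtain ⟨n, hn⟩ := h
  refine ⟨n, isNoetherian_of_injective ((act.postcompHom r.i).restrict (q := act.homGE X Y n)
    fun x hx i hi => by rw [coeff_postcompHom, hx i hi, Limits.zero_comp]) fun x y hxy =>
      Subtype.ext (HomStar.ext_coeff fun i => ?_)⟩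
  have h1 : (act.postcompHom r.i x.1).coeff act i = (act.postcompHom r.i y.1).coeff act i :=
    congrArg (fun z => HomStar.coeff act z.1 i) hxy
  rw [coeff_postcompHom, coeff_postcompHom] at h1
  rw [← Category.comp_id (x.1.coeff act i), ← Category.comp_id (y.1.coeff act i),
    ← CategoryTheory.Functor.map_id, ← r.retract, Functor.map_comp, ← Category.assoc, ← Category.assoc, h1]

/-- Precomposition with the identity of `ΣᵐX`, seen in degree `m`, is `R`-linear and shifts the
truncation by `m`. It is surjective because `σ` has the right inverse `τ`. -/
lemma EventuallyNoetherian.shift_left {X Y : T} (h : act.EventuallyNoetherian X Y) (m : ℤ) :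
    act.EventuallyNoetherian (X⟦m⟧) Y := by
  obtain ⟨n, hn⟩ := h
  obtain ⟨σ, τ, hστ⟩ := ShiftedHom.exists_comp_eq_id X m
  refine ⟨n + m, isNoetherian_of_surjective ((act.precomp σ).restrict fun x hx =>
    act.precomp_mem_homGE σ (rfl : n + m = n + m) hx)
    (LinearMap.range_eq_top.2 fun y => ⟨⟨act.precomp τ y.1,
      act.precomp_mem_homGE τ (by ring) y.2⟩, Subtype.ext (HomStar.ext_coeff fun i => ?_)⟩)⟩
  change (act.precomp σ (act.precomp τ y.1)).coeff act i = _
  rw [act.coeff_precomp σ _ (show i - m + m = i by ring),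
    act.coeff_precomp τ _ (show i + -m = i - m by ring),
    ← ShiftedHom.comp_assoc σ τ _ (neg_add_cancel m) _ (by ring), hστ, ShiftedHom.mk₀_id_comp]

variable [Limits.HasZeroObject T] [Pretriangulated T]

open Pretriangulated HomStar

lemma EventuallyNoetherian.of_distTriang_left {D : Triangle T} (hD : D ∈ distTriang T) {Y : T}
    (h₁ : act.EventuallyNoetherian D.obj₁ Y) (h₃ : act.EventuallyNoetherian D.obj₃ Y) :
    act.EventuallyNoetherian D.obj₂ Y := by
  obtain ⟨n₁, h₁⟩ := h₁.exists_ge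
  obtain ⟨n₃, h₃⟩ := h₃.exists_ge
  have := h₁ (max n₁ n₃) (le_max_left _ _)
  have := h₃ (max n₁ n₃) (le_max_right _ _)
  refine ⟨max n₁ n₃, isNoetherian_of_exact_submodules (p := act.homGE D.obj₃ Y (max n₁ n₃))
    (t := act.homGE D.obj₁ Y (max n₁ n₃)) (act.precompHom D.mor₂) (act.precompHom D.mor₁) ?_
    (fun x hx => act.precomp_mem_homGE _ (add_zero _) hx)
    (fun x hx => act.precomp_mem_homGE _ (add_zero _) hx) ?_⟩
  · intro x
    ext i
    rw [coeff_precompHom, coeff_precompHom, comp_distTriang_mor_zero₁₂_assoc _ hD,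
      Limits.zero_comp, coeff_zero]
  · intro b hb h0
    -- The lift is taken to be zero wherever the coefficient of `b` is, so that the lifts have
    -- finite support and stay in the same truncation.
    have h (i : ℤ) : ∃ a : ShiftedHom D.obj₃ Y i, D.mor₂ ≫ a = b.coeff act i ∧
        (b.coeff act i = 0 → a = 0) := by
      by_cases hi : b.coeff act i = 0
      · exact ⟨0, by rw [hi, Limits.comp_zero], fun _ => rfl⟩
      · have h1 : D.mor₁ ≫ b.coeff act i = 0 := by
          rw [← coeff_precompHom, h0, coeff_zero]
        obtain ⟨a, ha⟩ := Triangle.yoneda_exact₂ D hD _ h1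
        exact ⟨a, ha.symm, fun h => absurd h hi⟩
    choose a ha ha0 using h
    obtain ⟨x, hx⟩ := exists_coeff_eq b a ha0
    refine ⟨x, fun i hi => ?_, ?_⟩
    · rw [hx, ha0 i (hb i hi)]
    · ext i
      rw [coeff_precompHom, hx, ha]

/-- The shifted triangle carries the signs `(-1)ⁱ` on its maps; they are absorbed into the lift. -/
lemma coyoneda_exact₂_shift {D : Triangle T} (hD : D ∈ distTriang T) {X : T} (i : ℤ)
    (b : X ⟶ D.obj₂⟦i⟧) (hb : b ≫ D.mor₂⟦i⟧' = 0) : ∃ a : X ⟶ D.obj₁⟦i⟧, a ≫ D.mor₁⟦i⟧' = b := by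
  obtain ⟨a, ha⟩ : ∃ a : X ⟶ D.obj₁⟦i⟧, b = a ≫ (i.negOnePow • D.mor₁⟦i⟧') :=
    Triangle.coyoneda_exact₂ _ (Triangle.shift_distinguished D hD i) b (by
      change b ≫ (i.negOnePow • D.mor₂⟦i⟧') = 0
      rw [Linear.comp_units_smul, hb, smul_zero])
  exact ⟨i.negOnePow • a, by rw [ha, Linear.units_smul_comp, Linear.comp_units_smul]⟩

lemma EventuallyNoetherian.of_distTriang_right {D : Triangle T} (hD : D ∈ distTriang T) {X : T}
    (h₁ : act.EventuallyNoetherian X D.obj₁) (h₃ : act.EventuallyNoetherian X D.obj₃) :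
    act.EventuallyNoetherian X D.obj₂ := by
  obtain ⟨n₁, h₁⟩ := h₁.exists_ge
  obtain ⟨n₃, h₃⟩ := h₃.exists_ge
  have := h₁ (max n₁ n₃) (le_max_left _ _)
  have := h₃ (max n₁ n₃) (le_max_right _ _)
  refine ⟨max n₁ n₃, isNoetherian_of_exact_submodules (p := act.homGE X D.obj₁ (max n₁ n₃))
    (t := act.homGE X D.obj₃ (max n₁ n₃)) (act.postcompHom D.mor₁) (act.postcompHom D.mor₂) ?_
    (fun x hx i hi => ?_) (fun x hx i hi => ?_) ?_⟩
  · intro x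
    ext i
    rw [coeff_postcompHom, coeff_postcompHom, Category.assoc, ← Functor.map_comp,
      comp_distTriang_mor_zero₁₂ _ hD, Functor.map_zero, Limits.comp_zero, coeff_zero]
  · rw [coeff_postcompHom, hx i hi, Limits.zero_comp]
  · rw [coeff_postcompHom, hx i hi, Limits.zero_comp]
  · intro b hb h0
    have h (i : ℤ) : ∃ a : ShiftedHom X D.obj₁ i, a ≫ D.mor₁⟦i⟧' = b.coeff act i ∧
        (b.coeff act i = 0 → a = 0) := by
      by_cases hi : b.coeff act i = 0
      · exact ⟨0, by rw [hi, Limits.zero_comp], fun _ => rfl⟩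
      · have h1 : b.coeff act i ≫ D.mor₂⟦i⟧' = 0 := by
          rw [← coeff_postcompHom, h0, coeff_zero]
        obtain ⟨a, ha⟩ := coyoneda_exact₂_shift hD i _ h1
        exact ⟨a, ha, fun h => absurd h hi⟩
    choose a ha ha0 using h
    obtain ⟨x, hx⟩ := exists_coeff_eq b a ha0
    refine ⟨x, fun i hi => ?_, ?_⟩
    · rw [hx, ha0 i (hb i hi)]
    · ext i
      rw [coeff_postcompHom, hx, ha]

end CentralAction

/-- The sign `(-1)^{mn}` is trivial for even `n`. Even elements thus live in the commutative ring
`Subring.center R`, where radicals of ideals are available. -/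
lemma IsGradedCommutative.mem_center {R : Type*} [Ring R] {𝒜 : ℕ → AddSubgroup R} [GradedRing 𝒜]
    (hR : IsGradedCommutative 𝒜) {n : ℕ} (hn : Even n) {r : R} (hr : r ∈ 𝒜 n) :
    r ∈ Subring.center R := by
  rw [Subring.mem_center_iff]
  intro s
  induction s using DirectSum.Decomposition.inductionOn 𝒜 with
  | zero => simp
  | @homogeneous m s => rw [hR hr s.2, (hn.mul_right m).neg_one_pow, one_mul]
  | add s t hs ht => rw [add_mul, mul_add, hs, ht]

/-! ### Homogeneous generators, nilpotent actions and dévissage along cones. -/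

namespace CentralAction

variable {R : Type*} [Ring R] {T : Type*} [Category T] [Preadditive T] [HasShift T ℤ]
  [∀ n : ℤ, (shiftFunctor T n).Additive] {𝒜 : ℕ → AddSubgroup R} [GradedRing 𝒜]
  {act : CentralAction T 𝒜}

open HomStar

variable {X Y : T}

lemma coeff_smul_of_ne {m : ℕ} {r : R} (hr : r ∈ 𝒜 m) {i l : ℤ} (g : ShiftedHom X Y i)
    (hl : l ≠ m + i) : (r • HomStar.of act i g).coeff act l = 0 := by
  rw [smul_of ⟨r, hr⟩ g rfl, coeff_of_ne _ hl]

/-- The multiples of a homogeneous element by homogeneous elements of `R` with degrees in `D` are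
generated by finitely many of them, with homogeneous coefficients. -/
lemma exists_homogeneous_generators {n : ℤ} (hN : IsNoetherian R (act.homGE X Y n)) {i : ℤ}
    (g : ShiftedHom X Y i) (D : Set ℕ) (hD : ∀ m ∈ D, n ≤ m + i) :
    ∃ (t : Finset R) (d : R → ℕ), (∀ z ∈ t, d z ∈ D ∧ z ∈ 𝒜 (d z)) ∧
      ∀ m ∈ D, ∀ r ∈ 𝒜 m, ∃ s : R → R,
        (∀ z ∈ t, s z ∈ 𝒜 (m - d z) ∧ (m < d z → s z = 0)) ∧
        r • HomStar.of act i g = ∑ z ∈ t, s z • z • HomStar.of act i g := by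
  classical
  set w := HomStar.of act i g
  let G : Set (act.HomStar X Y) := {x | ∃ m ∈ D, ∃ r ∈ 𝒜 m, r • w = x}
  have hG : Submodule.span R G ≤ act.homGE X Y n := by
    rw [Submodule.span_le]
    rintro _ ⟨m, hm, r, hr, rfl⟩ l hl
    exact coeff_smul_of_ne hr g (by have := hD m hm; omega)
  -- The generators can be chosen among the multiples `r • w` themselves, hence with homogeneous
  -- `r`.
  obtain ⟨t', ht', hspan⟩ := (Submodule.fg_span_iff_fg_span_finset_subset G).1
    (isNoetherian_submodule.1 hN _ hG)
  have ht'' : ∀ x ∈ t', ∃ m : ℕ, m ∈ D ∧ ∃ r : R, r ∈ 𝒜 m ∧ r • w = x := fun x hx => ht' hx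
  choose! e heD ρ hρ hρw using ht''
  have hρ' : ∀ z ∈ t'.image ρ, ∃ d ∈ D, z ∈ 𝒜 d := by
    intro z hz
    obtain ⟨x, hx, rfl⟩ := Finset.mem_image.1 hz
    exact ⟨e x, heD x hx, hρ x hx⟩
  choose! d hdD hd using hρ'
  refine ⟨t'.image ρ, d, fun z hz => ⟨hdD z hz, hd z hz⟩, fun m hm r hr => ?_⟩
  have hmem : r • w ∈ Submodule.span R ((fun z : R => z • w) '' (t'.image ρ : Finset R)) := by
    have h1 : r • w ∈ Submodule.span R G := Submodule.subset_span ⟨m, hm, r, hr, rfl⟩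
    rw [hspan] at h1
    refine Submodule.span_mono ?_ h1
    intro x hx
    exact ⟨ρ x, Finset.mem_coe.2 (Finset.mem_image_of_mem ρ hx), hρw x hx⟩
  obtain ⟨c, hc⟩ := Submodule.mem_span_image_finset_iff_exists_fun' R |>.1 hmem
  -- Only the component of `c z` of degree `m - d z` contributes in degree `m + i`. The case
  -- distinction guards against truncated subtraction, which would select the degree `0` component.
  refine ⟨fun z => if d z ≤ m then (DirectSum.decompose 𝒜 (c z) (m - d z) : 𝒜 (m - d z)) else 0,
    fun z hz => ⟨?_, fun h => if_neg (by omega)⟩, ?_⟩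
  · dsimp only
    split_ifs
    · exact (DirectSum.decompose 𝒜 (c z) (m - d z)).2
    · exact zero_mem _
  · ext l
    rw [coeff_sum]
    by_cases hl : l = m + i
    · subst hl
      rw [← hc, coeff_sum]
      refine Finset.sum_congr rfl fun z hz => ?_
      dsimp only
      rw [smul_of ⟨z, hd z hz⟩ g rfl]
      by_cases hzm : d z ≤ m
      · have h := coeff_smul_of (act := act) (c z) (m - d z)
          (g.comp (centerApp (act.toCenter (d z) ⟨z, hd z hz⟩) Y) rfl)
        rw [show ((m - d z : ℕ) : ℤ) + ((d z : ℤ) + i) = m + i by push_cast [hzm]; ring] at h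
        rw [if_pos hzm, h]
      · rw [if_neg hzm, zero_smul]
        exact (act.homGE X Y (d z + i)).smul_mem (c z) (act.of_mem_homGE le_rfl _) _ (by omega)
    · rw [coeff_smul_of_ne hr g hl]
      refine (Finset.sum_eq_zero fun z hz => ?_).symm
      dsimp only
      by_cases hzm : d z ≤ m
      · rw [if_pos hzm, smul_smul]
        refine coeff_smul_of_ne (m := m) ?_ g hl
        have := SetLike.GradedMul.mul_mem (DirectSum.decompose 𝒜 (c z) (m - d z)).2 (hd z hz)
        rwa [Nat.sub_add_cancel hzm] at this
      · rw [if_neg hzm, zero_smul, coeff_zero]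

/-- If `Hom*(X, Y)` is eventually Noetherian and each homogeneous element of large degree is
annihilated by the elements of large degree of `R`, then `Hom(X, ΣⁱY) = 0` for `i ≫ 0`. -/
lemma EventuallyNoetherian.exists_forall_eq_zero (h : act.EventuallyNoetherian X Y) (n₁ : ℤ)
    (hw : ∀ i ≥ n₁, ∀ g : ShiftedHom X Y i, ∃ c : ℕ, ∀ m ≥ c, ∀ r ∈ 𝒜 m,
      r • HomStar.of act i g = 0) :
    ∃ n : ℤ, ∀ i ≥ n, ∀ g : ShiftedHom X Y i, g = 0 := by
  classical
  obtain ⟨n₀, hn₀⟩ := h.exists_ge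
  let n := max n₀ n₁
  let G : Set (act.HomStar X Y) := {x | ∃ i ≥ n, ∃ g : ShiftedHom X Y i, HomStar.of act i g = x}
  have hG : Submodule.span R G ≤ act.homGE X Y n := by
    rw [Submodule.span_le]
    rintro _ ⟨i, hi, g, rfl⟩
    exact act.of_mem_homGE hi g
  -- Finitely many homogeneous elements generate all those of degree at least `n`. The translates of
  -- each one vanish in large degrees, so the degrees reached are bounded above.
  obtain ⟨t, ht, hspan⟩ := (Submodule.fg_span_iff_fg_span_finset_subset G).1
    (isNoetherian_submodule.1 (hn₀ n (le_max_left _ _)) _ hG)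
  have hb : ∀ x ∈ t, ∃ b : ℤ, ∀ l ≥ b, ∀ r : R, (r • x).coeff act l = 0 := by
    intro x hx
    obtain ⟨i, hi, g, rfl⟩ := ht hx
    obtain ⟨c, hc⟩ := hw i (le_trans (le_max_right _ _) hi) g
    refine ⟨c + i, fun l hl r => ?_⟩
    obtain ⟨k, hk⟩ := Int.eq_ofNat_of_zero_le (show 0 ≤ l - i by omega)
    obtain rfl : l = k + i := by omega
    rw [coeff_smul_of, hc k (by omega) _ (DirectSum.decompose 𝒜 r k).2, coeff_zero]
  choose! b hb using hb
  obtain ⟨B, hB⟩ := (t.image b).bddAbove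
  refine ⟨max n B, fun i hi g => ?_⟩
  have h1 : HomStar.of act i g ∈ Submodule.span R (t : Set (act.HomStar X Y)) := by
    rw [← hspan]
    exact Submodule.subset_span ⟨i, le_trans (le_max_left _ _) hi, g, rfl⟩
  obtain ⟨c, -, hc⟩ := Submodule.mem_span_finset.1 h1
  rw [← coeff_of_same (act := act) i g, ← hc, coeff_sum]
  refine Finset.sum_eq_zero fun x hx => hb x hx i ?_ _
  exact le_trans (hB (Finset.mem_coe.2 (Finset.mem_image_of_mem b hx)))
    (le_trans (le_max_right _ _) hi)

variable (act) in
/-- The ideal of the center of `R` generated by the homogeneous elements of even degree that act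
trivially on `X`. -/
def evenAnnihilator (X : T) : Ideal (Subring.center R) :=
  Ideal.span {z | act.EvenKills z.1 X}

/-- The ideal of the central elements annihilating an element of a module. -/
def centralAnnihilator {M : Type*} [AddCommGroup M] [Module R M] (x : M) :
    Ideal (Subring.center R) where
  carrier := {z | z.1 • x = 0}
  zero_mem' := zero_smul R x
  add_mem' {y z} hy hz := by
    change (y.1 + z.1) • x = 0
    rw [add_smul, show y.1 • x = 0 from hy, show z.1 • x = 0 from hz, add_zero]
  smul_mem' y z hz := by
    change (y.1 * z.1) • x = 0
    rw [mul_smul, show z.1 • x = 0 from hz, smul_zero]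

/-- The action on `Hom*(X, Y)` is defined through `Y`, but an even element commutes with `g` and can
equally be applied at `X`. -/
lemma evenAnnihilator_le {m : ℕ} (g : ShiftedHom X Y (m : ℤ)) :
    act.evenAnnihilator X ≤ centralAnnihilator (HomStar.of act m g) := by
  refine Ideal.span_le.2 ?_
  rintro z ⟨n, hn, hz, h0⟩
  change z.1 • HomStar.of act m g = 0
  rw [smul_of ⟨z.1, hz⟩ g rfl, ShiftedHom.comp_centerApp ((Int.even_coe_nat n).2 hn), h0,
    ShiftedHom.zero_comp]
  exact map_zero _

/-- If all elements of `R` of positive even degree act nilpotently on `X` and `Hom*(X, Y)` is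
eventually Noetherian, then `Hom(X, ΣⁱY) = 0` for `i ≫ 0`. -/
lemma EventuallyNoetherian.exists_forall_eq_zero_of_radical (h : act.EventuallyNoetherian X Y)
    (hR : IsGradedCommutative 𝒜)
    (hX : ∀ (m : ℕ) (hm : Even m), 0 < m → ∀ (r : R) (hr : r ∈ 𝒜 m),
      (⟨r, hR.mem_center hm hr⟩ : Subring.center R) ∈ (act.evenAnnihilator X).radical) :
    ∃ n : ℤ, ∀ i ≥ n, ∀ g : ShiftedHom X Y i, g = 0 := by
  classical
  obtain ⟨n₀, hn₀⟩ := h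
  refine EventuallyNoetherian.exists_forall_eq_zero ⟨n₀, hn₀⟩ (max n₀ 0) fun i hi g => ?_
  have hin₀ : n₀ ≤ i := le_trans (le_max_left _ _) hi
  obtain ⟨k, rfl⟩ := Int.eq_ofNat_of_zero_le (le_trans (le_max_right _ _) hi)
  set w := HomStar.of act k g
  have heven : ∃ c : ℕ, ∀ m ≥ c, Even m → ∀ r ∈ 𝒜 m, r • w = 0 := by
    obtain ⟨t, d, ht, hgen⟩ := exists_homogeneous_generators hn₀ g {m | Even m ∧ 0 < m}
      (fun m _ => by omega)
    have hcen : ∀ z ∈ t, z ∈ Subring.center R := fun z hz =>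
      hR.mem_center (ht z hz).1.1 (ht z hz).2
    -- As `J` is finitely generated and lies in the radical of the annihilator of `w`, a power of
    -- `J` annihilates `w`.
    let J : Ideal (Subring.center R) :=
      Ideal.span (Set.range fun z : t => (⟨z.1, hcen z.1 z.2⟩ : Subring.center R))
    have hJ : J ≤ (centralAnnihilator w).radical := by
      refine le_trans (Ideal.span_le.2 ?_) (Ideal.radical_mono (evenAnnihilator_le g))
      rintro _ ⟨z, rfl⟩
      exact hX _ (ht z.1 z.2).1.1 (ht z.1 z.2).1.2 z.1 (ht z.1 z.2).2
    obtain ⟨N, hN⟩ := Ideal.exists_pow_le_of_le_radical_of_fg hJ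
      (Submodule.fg_span (Set.finite_range _))
    -- On `w`, even elements of large degree act like elements of `J ^ N`: one generator is split
    -- off at a time, and the remaining coefficient still has large even degree.
    have key : ∀ N : ℕ, ∃ c : ℕ, ∀ m ≥ c, Even m → ∀ r ∈ 𝒜 m, ∃ z ∈ J ^ N, r • w = z.1 • w := by
      intro N
      induction N with
      | zero => exact ⟨0, fun m _ hm r hr => ⟨⟨r, hR.mem_center hm hr⟩, by simp, rfl⟩⟩
      | succ N ih =>
        obtain ⟨c, hc⟩ := ih
        -- The sum ensures `m - d z ≥ c` for every generator, and the `1` ensures `0 < m`.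
        refine ⟨c + ∑ z ∈ t, d z + 1, fun m hm hme r hr => ?_⟩
        obtain ⟨s, hs, hrs⟩ := hgen m ⟨hme, by omega⟩ r hr
        have hdm : ∀ z ∈ t, d z + c ≤ m := fun z hz => by
          have := Finset.single_le_sum (f := d) (fun _ _ => Nat.zero_le _) hz
          omega
        have h1 : ∀ z : t, ∃ y ∈ J ^ N, s z.1 • w = y.1 • w := fun z =>
          hc _ (by have := hdm z.1 z.2; omega)
            (hme.tsub (ht z.1 z.2).1.1) _ (hs z.1 z.2).1
        choose y hyJ hy using h1
        refine ⟨∑ z : t, ⟨z.1, hcen z.1 z.2⟩ * y z, ?_, ?_⟩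
        · rw [pow_succ']
          exact Ideal.sum_mem _ fun z _ => Ideal.mul_mem_mul
            (Ideal.subset_span ⟨z, rfl⟩) (hyJ z)
        · rw [hrs, ← Finset.sum_coe_sort, AddSubmonoidClass.coe_finsetSum, Finset.sum_smul]
          refine Finset.sum_congr rfl fun z _ => ?_
          change _ = (z.1 * (y z).1) • w
          rw [mul_smul, ← hy, smul_smul, smul_smul,
            Subring.mem_center_iff.1 (hcen z.1 z.2) (s z.1)]
    obtain ⟨c, hc⟩ := key N
    refine ⟨c, fun m hm hme r hr => ?_⟩
    obtain ⟨z, hz, hrz⟩ := hc m hm hme r hr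
    rw [hrz]
    exact hN hz
  obtain ⟨c, hc⟩ := heven
  -- Odd degrees reduce to even ones: the coefficients over odd generators have even degree, hence
  -- are central and, for large `m`, annihilate `w`.
  obtain ⟨t, d, ht, hgen⟩ := exists_homogeneous_generators hn₀ g {m | Odd m} (fun m _ => by omega)
  refine ⟨c + ∑ z ∈ t, d z, fun m hm r hr => ?_⟩
  rcases Nat.even_or_odd m with hme | hmo
  · exact hc m (by omega) hme r hr
  · obtain ⟨s, hs, hrs⟩ := hgen m hmo r hr
    rw [hrs]
    refine Finset.sum_eq_zero fun z hz => ?_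
    have := Finset.single_le_sum (f := d) (fun _ _ => Nat.zero_le _) hz
    have hev : Even (m - d z) := Nat.Odd.sub_odd hmo (ht z hz).1
    rw [smul_smul, ← Subring.mem_center_iff.1 (hR.mem_center hev (hs z hz).1) z, mul_smul,
      hc _ (by omega) hev _ (hs z hz).1, smul_zero]

variable [Limits.HasZeroObject T] [Pretriangulated T]

open Pretriangulated

section Cone

variable {n : ℕ} (r : 𝒜 n) {K : T} {j : X⟦(n : ℤ)⟧ ⟶ K} {p : K ⟶ X⟦(1 : ℤ)⟧}

/-- In the rotated triangle `K` lies between `ΣⁿX` and `ΣX`, both killed by `z`, so `z²` kills `K`.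
-/
lemma evenAnnihilator_le_radical_cone
    (hD : Triangle.mk (centerApp (act.toCenter n r) X) j p ∈ distTriang T) :
    act.evenAnnihilator X ≤ (act.evenAnnihilator K).radical := by
  refine Ideal.span_le.2 fun z hz => ⟨2, Ideal.subset_span ?_⟩
  change act.EvenKills (z ^ 2).1 K
  rw [pow_two]
  have h1 := EvenKills.shift hz 1
  rw [Nat.cast_one] at h1
  exact EvenKills.mul_of_distTriang (rot_of_distTriang _ hD) h1 (EvenKills.shift hz n)

lemma mem_radical_evenAnnihilator_cone (hn : Even n) (hr : r.1 ∈ Subring.center R)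
    (hD : Triangle.mk (centerApp (act.toCenter n r) X) j p ∈ distTriang T) :
    (⟨r.1, hr⟩ : Subring.center R) ∈ (act.evenAnnihilator K).radical := by
  refine ⟨2, Ideal.subset_span ?_⟩
  rw [pow_two]
  exact evenKills_mul_self_of_distTriang hn r hD

lemma EventuallyNoetherian.cone (h : act.EventuallyNoetherian X Y)
    (hD : Triangle.mk (centerApp (act.toCenter n r) X) j p ∈ distTriang T) :
    act.EventuallyNoetherian K Y :=
  EventuallyNoetherian.of_distTriang_left (rot_of_distTriang _ hD) (h.shift_left n) (h.shift_left 1)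

end Cone

/-- Dévissage along cones of elements of `R`: if `Hom*(X, X)` and `Hom*(X, Y)` are eventually
Noetherian, then finitely many cones of elements of positive even degree lead from `X` to an object
`K` with `Hom(K, ΣⁱY) = 0` for `i ≫ 0`. -/
lemma EventuallyNoetherian.cone_induction (hR : IsGradedCommutative 𝒜) {Q : T → Prop}
    (hXX : act.EventuallyNoetherian X X) (hXY : act.EventuallyNoetherian X Y)
    (base : ∀ K : T, (∃ n : ℤ, ∀ i ≥ n, ∀ g : ShiftedHom K Y i, g = 0) → Q K)
    (step : ∀ (X K : T) (n : ℕ) (_ : 0 < n) (r : 𝒜 n) (j : X⟦(n : ℤ)⟧ ⟶ K) (p : K ⟶ X⟦(1 : ℤ)⟧),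
      Triangle.mk (centerApp (act.toCenter n r) X) j p ∈ distTriang T → Q K → Q X) :
    Q X := by
  obtain ⟨n₀, hn₀⟩ := hXX
  -- At least `n₀`, so that multiples of `𝟙 X` of degree `≥ N` lie in the Noetherian truncation, and
  -- positive, so that the generators have positive degree.
  let N : ℕ := n₀.toNat + 1
  -- Induction on the list of elements still to be coned off. The invariant is that even elements of
  -- degree `≥ N` lie in the radical of the even annihilator of the current object plus the ideal of
  -- `l`; each cone moves one element into the radical.
  have key : ∀ (l : List (Subring.center R)) (X : T), act.EventuallyNoetherian X Y →
      (∀ z ∈ l, ∃ n : ℕ, 0 < n ∧ Even n ∧ z.1 ∈ 𝒜 n) →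
      (∀ (m : ℕ) (hm : Even m), N ≤ m → ∀ (r : R) (hr : r ∈ 𝒜 m),
        (⟨r, hR.mem_center hm hr⟩ : Subring.center R) ∈
          (act.evenAnnihilator X).radical ⊔ Ideal.span {z | z ∈ l}) → Q X := by
    intro l
    induction l with
    | nil =>
      intro X hXY _ hX
      refine base X (hXY.exists_forall_eq_zero_of_radical hR fun m hm hm0 r hr => ?_)
      -- The invariant only covers degrees `≥ N`; for smaller positive `m` it applies to a power of
      -- `r`.
      have h1 : r ^ N ∈ 𝒜 (N * m) := by
        simpa using SetLike.pow_mem_graded N hr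
      have h2 := hX (N * m) (hm.mul_left N) (Nat.le_mul_of_pos_right N hm0) _ h1
      simp only [List.not_mem_nil, Set.ofPred_false, Ideal.span_empty, sup_bot_eq] at h2
      rw [← Ideal.radical_idem]
      exact ⟨N, h2⟩
    | cons z l ih =>
      intro X hXY hl hX
      obtain ⟨n, hn0, hn, hz⟩ := hl z (by simp)
      obtain ⟨K, j, p, hD⟩ := distinguished_cocone_triangle (centerApp (act.toCenter n ⟨z.1, hz⟩) X)
      refine step X K n hn0 _ j p hD (ih K (hXY.cone _ hD) (fun y hy => hl y (by simp [hy]))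
        fun m hm hNm r hr => ?_)
      refine (show (act.evenAnnihilator X).radical ⊔ Ideal.span {y | y ∈ z :: l} ≤ _ from
        sup_le ?_ (Ideal.span_le.2 ?_)) (hX m hm hNm r hr)
      · refine le_sup_of_le_left ?_
        rw [← Ideal.radical_idem (act.evenAnnihilator K)]
        exact Ideal.radical_mono (evenAnnihilator_le_radical_cone _ hD)
      · intro y hy
        rcases List.mem_cons.1 hy with rfl | hy
        · exact Ideal.mem_sup_left (mem_radical_evenAnnihilator_cone ⟨y.1, hz⟩ hn y.2 hD)
        · exact Ideal.mem_sup_right (Ideal.subset_span hy)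
  classical
  obtain ⟨t, d, ht, hgen⟩ := exists_homogeneous_generators hn₀
    (ShiftedHom.mk₀ (0 : ℤ) rfl (𝟙 X)) {m | Even m ∧ N ≤ m}
    (fun m hm => by have := hm.2; omega)
  have hcen : ∀ z ∈ t, z ∈ Subring.center R := fun z hz =>
    hR.mem_center (ht z hz).1.1 (ht z hz).2
  refine key (t.attach.toList.map fun z => ⟨z.1, hcen z.1 z.2⟩) X hXY ?_ ?_
  · intro y hy
    obtain ⟨z, -, rfl⟩ := List.mem_map.1 hy
    exact ⟨d z.1, lt_of_lt_of_le (Nat.succ_pos _) (ht z.1 z.2).1.2, (ht z.1 z.2).1.1,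
      (ht z.1 z.2).2⟩
  · intro m hm hNm r hr
    obtain ⟨s, hs, hrs⟩ := hgen m ⟨hm, hNm⟩ r hr
    have hs' : ∀ z ∈ t, s z ∈ Subring.center R := fun z hz => by
      by_cases hzm : d z ≤ m
      · exact hR.mem_center (hm.tsub (ht z hz).1.1) (hs z hz).1
      · rw [(hs z hz).2 (by omega)]
        exact zero_mem _
    have hsz : ∀ z ∈ t, s z * z ∈ 𝒜 m := fun z hz => by
      by_cases hzm : d z ≤ m
      · have := SetLike.GradedMul.mul_mem (hs z hz).1 (ht z hz).2
        rwa [Nat.sub_add_cancel hzm] at this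
      · rw [(hs z hz).2 (by omega), zero_mul]
        exact zero_mem _
    -- The difference annihilates `𝟙 X`, so it acts trivially on `X`; thus `r` lies in the even
    -- annihilator plus the ideal of the generators.
    let b : R := r - ∑ z ∈ t, s z * z
    have hb : b ∈ 𝒜 m := sub_mem hr (sum_mem hsz)
    have hbX : act.EvenKills b X := by
      refine ⟨m, hm, hb, ?_⟩
      have h1 : b • HomStar.of act 0 (ShiftedHom.mk₀ (0 : ℤ) rfl (𝟙 X)) = 0 := by
        rw [sub_smul, hrs, Finset.sum_smul, sub_eq_zero]
        exact Finset.sum_congr rfl fun z _ => smul_smul _ _ _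
      rw [smul_of ⟨b, hb⟩ _ (add_zero (m : ℤ)), ShiftedHom.mk₀_id_comp] at h1
      rw [← coeff_of_same (act := act) (m : ℤ) (centerApp (act.toCenter m ⟨b, hb⟩) X), h1,
        coeff_zero]
    have hdec : (⟨r, hR.mem_center hm hr⟩ : Subring.center R) =
        ⟨b, hR.mem_center hm hb⟩ + ∑ z : t, ⟨s z.1, hs' z.1 z.2⟩ * ⟨z.1, hcen z.1 z.2⟩ := by
      apply Subtype.ext
      rw [Subring.coe_add, AddSubmonoidClass.coe_finsetSum]
      change r = b + ∑ z : t, s z.1 * z.1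
      rw [Finset.sum_coe_sort t (fun z => s z * z)]
      simp [b]
    rw [hdec]
    refine Ideal.add_mem _ (Ideal.mem_sup_left (Ideal.le_radical (Ideal.subset_span hbX)))
      (Ideal.sum_mem _ fun z _ => Ideal.mem_sup_right (Ideal.mul_mem_left _ _
        (Ideal.subset_span ?_)))
    exact List.mem_map.2 ⟨z, by simp, rfl⟩

end CentralAction

/-! ### Finitely generated modules over an Artinian ring -/

section FG

variable {Λ : Type u} [Ring Λ]

/-- The short exact sequence of a submodule. -/
def submoduleShortComplex {M : Type u} [AddCommGroup M] [Module Λ M] (N : Submodule Λ M) :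
    ShortComplex (ModuleCat.{u} Λ) :=
  ShortComplex.mk (X₁ := ModuleCat.of Λ N) (X₂ := ModuleCat.of Λ M) (X₃ := ModuleCat.of Λ (M ⧸ N))
    (ModuleCat.ofHom N.subtype) (ModuleCat.ofHom N.mkQ) (by ext x; simp)

lemma submoduleShortComplex_shortExact {M : Type u} [AddCommGroup M] [Module Λ M]
    (N : Submodule Λ M) : (submoduleShortComplex N).ShortExact where
  exact := by
    rw [ShortComplex.ShortExact.moduleCat_exact_iff_function_exact]
    exact LinearMap.exact_subtype_mkQ N
  mono_f := (ModuleCat.mono_iff_injective _).2 N.injective_subtype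
  epi_g := (ModuleCat.epi_iff_surjective _).2 N.mkQ_surjective

lemma isSemisimpleModule_quotient_jacobson [IsArtinianRing Λ] :
    IsSemisimpleModule Λ (Λ ⧸ Ring.jacobson Λ) :=
  (IsArtinian.isSemisimpleModule_iff_jacobson Λ _).2 (Module.jacobson_quotient_jacobson Λ Λ)

/-- A simple module over an Artinian ring is a direct summand of `Λ/𝔯`. -/
lemma nonempty_retract_of_isSimpleModule [IsArtinianRing Λ] (L : Type u) [AddCommGroup L]
    [Module Λ L] [IsSimpleModule Λ L] :
    Nonempty (Retract (ModuleCat.of Λ L) (ModuleCat.of Λ (Λ ⧸ Ring.jacobson Λ))) := by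
  obtain ⟨I, hI, ⟨e⟩⟩ := isSimpleModule_iff_quot_maximal.1 ‹IsSimpleModule Λ L›
  have hle : Ring.jacobson Λ ≤ I := Ring.jacobson_le_of_isMaximal I
  let p : (Λ ⧸ Ring.jacobson Λ) →ₗ[Λ] L := e.symm.toLinearMap ∘ₗ Submodule.factor hle
  have hp : Function.Surjective p := e.symm.surjective.comp (Submodule.factor_surjective hle)
  have := isSemisimpleModule_quotient_jacobson (Λ := Λ)
  obtain ⟨s, hs⟩ := IsSemisimpleModule.lifting_property p hp LinearMap.id
  exact ⟨⟨ModuleCat.ofHom s, ModuleCat.ofHom p, by ext x; exact LinearMap.congr_fun hs x⟩⟩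

/-- A property of modules that holds for `Λ/𝔯` and is inherited by direct summands and extensions
holds for all finitely generated modules. -/
lemma fg_induction [IsArtinianRing Λ] {Q : ModuleCat.{u} Λ → Prop}
    (top : Q (ModuleCat.of Λ (Λ ⧸ Ring.jacobson Λ)))
    (retract : ∀ {M N : ModuleCat.{u} Λ}, Module.Finite Λ M → Module.Finite Λ N →
      Retract N M → Q M → Q N)
    (ext : ∀ {S : ShortComplex (ModuleCat.{u} Λ)}, S.ShortExact → Module.Finite Λ S.X₁ →
      Module.Finite Λ S.X₂ → Module.Finite Λ S.X₃ → Q S.X₁ → Q S.X₃ → Q S.X₂)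
    (M : ModuleCat.{u} Λ) [Module.Finite Λ M] : Q M := by
  have h : IsFiniteLength Λ M := isFiniteLength_iff_isNoetherian_isArtinian.2
    ⟨inferInstance, inferInstance⟩
  suffices ∀ (M : Type u) [AddCommGroup M] [Module Λ M], IsFiniteLength Λ M →
      Q (ModuleCat.of Λ M) from this M h
  intro M _ _ h
  induction h with
  -- The zero module is a direct summand of `Λ/𝔯`.
  | @of_subsingleton M _ _ _ =>
    exact retract (M := ModuleCat.of Λ (Λ ⧸ Ring.jacobson Λ))
      (inferInstanceAs (Module.Finite Λ (Λ ⧸ Ring.jacobson Λ)))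
      (inferInstanceAs (Module.Finite Λ M)) ⟨0, 0, by ext x; exact Subsingleton.elim _ _⟩ top
  | @of_simple_quotient M _ _ N hN hfl ih =>
    have h1 := isFiniteLength_iff_isNoetherian_isArtinian.1 (IsFiniteLength.of_simple_quotient hfl)
    have := h1.1
    refine ext (submoduleShortComplex_shortExact N) (inferInstanceAs (Module.Finite Λ N))
      (inferInstanceAs (Module.Finite Λ M)) (inferInstanceAs (Module.Finite Λ (M ⧸ N))) ih ?_
    obtain ⟨ρ⟩ := nonempty_retract_of_isSimpleModule (Λ := Λ) (M ⧸ N)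
    exact retract (inferInstanceAs (Module.Finite Λ (Λ ⧸ Ring.jacobson Λ)))
      (inferInstanceAs (Module.Finite Λ (M ⧸ N))) ρ top

lemma finite_X₂_of_exact [IsNoetherianRing Λ] {S : ShortComplex (ModuleCat.{u} Λ)} (hS : S.Exact)
    (h₁ : Module.Finite Λ S.X₁) (h₃ : Module.Finite Λ S.X₃) : Module.Finite Λ S.X₂ := by
  rw [ShortComplex.ShortExact.moduleCat_exact_iff_function_exact] at hS
  have : IsNoetherian Λ S.X₁ := isNoetherian_of_isNoetherianRing_of_finite Λ _
  have : IsNoetherian Λ S.X₃ := isNoetherian_of_isNoetherianRing_of_finite Λ _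
  have : IsNoetherian Λ S.X₂ := isNoetherian_of_range_eq_ker S.f.hom S.g.hom
    hS.linearMap_ker_eq.symm
  infer_instance

end FG

/-! ### The triangulated structure of the bounded derived category -/

section Db

open Pretriangulated ZeroObject

variable {Λ : Type u} [Ring Λ] [HasDerivedCategory.{w} (ModuleCat.{u} Λ)]

/-- In the long exact homology sequence the middle term is squeezed between the outer ones, which
gives boundedness, and finite generation because `Λ` is Noetherian. -/
instance [IsNoetherianRing Λ] : (isBoundedFG Λ).IsTriangulated where
  exists_zero := ⟨0, Limits.isZero_zero _, ⟨0, 0, fun i _ =>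
      Functor.map_isZero _ (Limits.isZero_zero _)⟩, fun i => by
    have := ModuleCat.subsingleton_of_isZero (Functor.map_isZero
      (DerivedCategory.homologyFunctor (ModuleCat.{u} Λ) i)
      (Limits.isZero_zero (DerivedCategory (ModuleCat.{u} Λ))))
    infer_instance⟩
  ext₂' D hD h₁ h₃ := by
    refine ObjectProperty.le_isoClosure _ _ ?_
    obtain ⟨⟨a₁, b₁, h₁⟩, f₁⟩ := h₁
    obtain ⟨⟨a₃, b₃, h₃⟩, f₃⟩ := h₃
    refine ⟨⟨min a₁ a₃, max b₁ b₃, fun i hi => ?_⟩, fun i =>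
      finite_X₂_of_exact (DerivedCategory.HomologySequence.exact₂ D hD i) (f₁ i) (f₃ i)⟩
    refine (DerivedCategory.HomologySequence.exact₂ D hD i).isZero_X₂
      ((h₁ i ?_).eq_of_src _ _) ((h₃ i ?_).eq_of_tgt _ _)
    · rcases hi with hi | hi
      · exact .inl (lt_of_lt_of_le hi (min_le_left _ _))
      · exact .inr (lt_of_le_of_lt (le_max_left _ _) hi)
    · rcases hi with hi | hi
      · exact .inl (lt_of_lt_of_le hi (min_le_right _ _))
      · exact .inr (lt_of_le_of_lt (le_max_right _ _) hi)

namespace BoundedDerivedCategory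

section

variable {M N K : ModuleCat.{u} Λ} [Module.Finite Λ M] [Module.Finite Λ N] [Module.Finite Λ K]

/-- The morphism between stalk complexes given by a linear map. -/
noncomputable def mapModule (f : M ⟶ N) : ofModule M ⟶ ofModule N :=
  ObjectProperty.homMk ((DerivedCategory.singleFunctor (ModuleCat.{u} Λ) 0).map f)

lemma mapModule_id : mapModule (𝟙 M) = 𝟙 (ofModule M) := by
  ext
  exact (DerivedCategory.singleFunctor (ModuleCat.{u} Λ) 0).map_id M

lemma mapModule_comp (f : M ⟶ N) (g : N ⟶ K) :
    mapModule (f ≫ g) = mapModule f ≫ mapModule g := by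
  ext
  exact (DerivedCategory.singleFunctor (ModuleCat.{u} Λ) 0).map_comp f g

lemma mapModule_sum {ι : Type*} (s : Finset ι) (f : ι → (M ⟶ N)) :
    mapModule (∑ i ∈ s, f i) = ∑ i ∈ s, mapModule (f i) := by
  apply (isBoundedFG Λ).ι.map_injective
  rw [Functor.map_sum]
  exact (DerivedCategory.singleFunctor (ModuleCat.{u} Λ) 0).map_sum f s

/-- A direct summand gives a direct summand. -/
noncomputable def retractOfModule (r : Retract M N) : Retract (ofModule M) (ofModule N) where
  i := mapModule r.i
  r := mapModule r.r
  retract := by rw [← mapModule_comp, r.retract, mapModule_id]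

/-- `Hom(M, ΣⁿN) = Extⁿ(M, N)` in the bounded derived category. -/
noncomputable def shiftedHomEquivExt (n : ℕ) :
    ShiftedHom (ofModule M) (ofModule N) (n : ℤ) ≃ Ext.{u} M N n :=
  (((isBoundedFG Λ).fullyFaithfulι.homEquiv (X := ofModule M)
    (Y := (ofModule N)⟦(n : ℤ)⟧)).trans
      (Iso.homToEquiv (((isBoundedFG Λ).ι.commShiftIso (n : ℤ)).app (ofModule N)))).trans
        Ext.homEquiv.symm

lemma subsingleton_ext_iff (n : ℕ) : Subsingleton (Ext.{u} M N n) ↔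
    ∀ g : ShiftedHom (ofModule M) (ofModule N) (n : ℤ), g = 0 := by
  rw [← (shiftedHomEquivExt (M := M) (N := N) n).subsingleton_congr]
  exact ⟨fun _ g => Subsingleton.elim _ _, fun h => ⟨fun a b => (h a).trans (h b).symm⟩⟩

end

/-- A short exact sequence of finitely generated modules gives a distinguished triangle. -/
lemma exists_distTriang [IsNoetherianRing Λ] {S : ShortComplex (ModuleCat.{u} Λ)}
    (hS : S.ShortExact) [Module.Finite Λ S.X₁] [Module.Finite Λ S.X₂] [Module.Finite Λ S.X₃] :
    ∃ δ : ofModule S.X₃ ⟶ (ofModule S.X₁)⟦(1 : ℤ)⟧,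
      Triangle.mk (mapModule S.f) (mapModule S.g) δ ∈ distTriang (BoundedDerivedCategory Λ) := by
  let c := ((isBoundedFG Λ).ι.commShiftIso (1 : ℤ)).app (ofModule S.X₁)
  -- The connecting map of the ambient derived category, lifted along the fully faithful inclusion;
  -- `c` compares the two shifts.
  refine ⟨(isBoundedFG Λ).fullyFaithfulι.preimage (X := ofModule S.X₃)
    (Y := (ofModule S.X₁)⟦(1 : ℤ)⟧) (hS.singleδ ≫ c.inv), ?_⟩
  refine isomorphic_distinguished _ hS.singleTriangle_distinguished _
    (Triangle.isoMk _ _ (Iso.refl _) (Iso.refl _) (Iso.refl _) ?_ ?_ ?_)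
  · exact (Category.comp_id _).trans (Category.id_comp _).symm
  · exact (Category.comp_id _).trans (Category.id_comp _).symm
  · have h1 : (isBoundedFG Λ).ι.map ((isBoundedFG Λ).fullyFaithfulι.preimage
        (X := ofModule S.X₃) (Y := (ofModule S.X₁)⟦(1 : ℤ)⟧) (hS.singleδ ≫ c.inv)) =
          hS.singleδ ≫ c.inv :=
      (isBoundedFG Λ).fullyFaithfulι.map_preimage _
    have h2 : (isBoundedFG Λ).ι.map ((isBoundedFG Λ).fullyFaithfulι.preimage
        (X := ofModule S.X₃) (Y := (ofModule S.X₁)⟦(1 : ℤ)⟧) (hS.singleδ ≫ c.inv)) ≫ c.hom =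
          hS.singleδ := by
      rw [h1]
      exact (Category.assoc _ _ _).trans
        ((congrArg (hS.singleδ ≫ ·) c.inv_hom_id).trans (Category.comp_id _))
    refine (congrArg (_ ≫ ·) (CategoryTheory.Functor.map_id _ _)).trans ?_
    exact (Category.comp_id _).trans (h2.trans (Category.id_comp _).symm)

end BoundedDerivedCategory

end Db

/-! ### Vanishing of morphisms and cones -/

section Vanishing

open Pretriangulated

variable {T : Type*} [Category T] [Preadditive T] [HasShift T ℤ]

/-- Writing the identity of `ΣᵐX` as `σ` followed by `τ`, the map `g` factors through a map `X ⟶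
ΣʲY`. -/
lemma ShiftedHom.eq_zero_of_shift {X Y : T} {m i j : ℤ} (hij : j + m = i)
    (h : ∀ g : ShiftedHom X Y j, g = 0) [∀ n : ℤ, (shiftFunctor T n).Additive]
    (g : X⟦m⟧ ⟶ Y⟦i⟧) : g = 0 := by
  obtain ⟨σ, τ, hστ⟩ := ShiftedHom.exists_comp_eq_id X m
  rw [← ShiftedHom.mk₀_id_comp (0 : ℤ) rfl (Y := Y) (a := i) g, ← hστ,
    ShiftedHom.comp_assoc σ τ (Z := X⟦m⟧) (T := Y) (a₃ := i) g (neg_add_cancel m)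
      (show i + -m = j by omega) (by omega), h (τ.comp (Z := Y) (b := i) g (by omega)),
    ShiftedHom.comp_zero]

variable [∀ n : ℤ, (shiftFunctor T n).Additive] [Limits.HasZeroObject T] [Pretriangulated T]
  {X K Y : T} {n : ℕ} {f : X ⟶ X⟦(n : ℤ)⟧} {j : X⟦(n : ℤ)⟧ ⟶ K} {p : K ⟶ X⟦(1 : ℤ)⟧}

/-- `Hom(K, ΣⁱY)` lies between `Hom(ΣX, ΣⁱY)` and `Hom(ΣⁿX, ΣⁱY)`, that is, between degrees `i - 1`
and `i - n` for `X`. Both exceed `a`. -/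
lemma ShiftedHom.eq_zero_of_cone (hD : Triangle.mk f j p ∈ distTriang T) (hn : 0 < n) {a : ℤ}
    (h : ∀ i > a, ∀ g : ShiftedHom X Y i, g = 0) :
    ∀ i > a + n, ∀ g : ShiftedHom K Y i, g = 0 := by
  intro i hi g
  obtain ⟨v, rfl⟩ : ∃ v, g = p ≫ v := Triangle.yoneda_exact₃ _ hD g
    (ShiftedHom.eq_zero_of_shift (sub_add_cancel i n) (h _ (by omega)) _)
  rw [ShiftedHom.eq_zero_of_shift (sub_add_cancel i 1) (h _ (by omega)) v, Limits.comp_zero]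

/-- For `i > a`, the vanishing of `Hom(K, Σⁱ⁺ⁿY)` makes precomposition of `Σⁿg` with `f` injective.
So `Hom(X, ΣⁱY)` embeds into `Hom(X, Σⁱ⁺ⁿY)`, and iterating reaches the range where the groups are
known to vanish. -/
lemma ShiftedHom.eq_zero_of_cone_eq_zero (hD : Triangle.mk f j p ∈ distTriang T) (hn : 0 < n)
    {a : ℤ} (hK : ∀ i > a + n, ∀ g : ShiftedHom K Y i, g = 0)
    (h : ∃ b : ℤ, ∀ i ≥ b, ∀ g : ShiftedHom X Y i, g = 0) :
    ∀ i > a, ∀ g : ShiftedHom X Y i, g = 0 := by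
  have hstep : ∀ i > a, (∀ g : ShiftedHom X Y (i + n), g = 0) → ∀ g : ShiftedHom X Y i, g = 0 := by
    intro i hi h0 g
    let g' : X⟦(n : ℤ)⟧ ⟶ Y⟦i + n⟧ := g⟦(n : ℤ)⟧' ≫ (shiftFunctorAdd T i n).inv.app Y
    obtain ⟨v, hv⟩ : ∃ v, g' = j ≫ v := Triangle.yoneda_exact₂ _ hD g' (h0 _)
    have h1 : g' = 0 := by rw [hv, hK (i + n) (by omega) v, Limits.comp_zero]
    have h2 : g⟦(n : ℤ)⟧' = 0 := by
      rw [← cancel_mono ((shiftFunctorAdd T i n).inv.app Y), Limits.zero_comp]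
      exact h1
    exact (shiftFunctor T (n : ℤ)).map_injective (h2.trans (Functor.map_zero _ _ _).symm)
  obtain ⟨b, hb⟩ := h
  have key : ∀ k : ℕ, ∀ i > a, b - k * n ≤ i → ∀ g : ShiftedHom X Y i, g = 0 := by
    intro k
    induction k with
    | zero => intro i _ hi; exact hb i (by simpa using hi)
    | succ k ih =>
      intro i hia hi
      refine hstep i hia (ih (i + n) (by omega) ?_)
      push_cast at hi
      linarith
  intro i hi
  refine key (b - i).toNat i hi ?_
  have h1 : b - i ≤ (b - i).toNat := Int.self_le_toNat _
  have h2 : ((b - i).toNat : ℤ) * 1 ≤ (b - i).toNat * n :=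
    mul_le_mul_of_nonneg_left (by omega) (by positivity)
  linarith

end Vanishing

/-! ### Presentations of modules -/

section Presentation

variable {Λ : Type u} [Ring Λ]

/-- The short exact sequence of a surjective map. -/
def kerShortComplex {M N : ModuleCat.{u} Λ} (p : M ⟶ N) : ShortComplex (ModuleCat.{u} Λ) :=
  ShortComplex.mk (X₁ := ModuleCat.of Λ (LinearMap.ker p.hom))
    (ModuleCat.ofHom (LinearMap.ker p.hom).subtype) p (by ext x; exact x.2)

lemma kerShortComplex_shortExact {M N : ModuleCat.{u} Λ} (p : M ⟶ N)
    (hp : Function.Surjective p.hom) : (kerShortComplex p).ShortExact where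
  exact := by
    rw [ShortComplex.ShortExact.moduleCat_exact_iff_function_exact]
    exact LinearMap.exact_subtype_ker_map p.hom
  mono_f := (ModuleCat.mono_iff_injective _).2 (LinearMap.ker p.hom).injective_subtype
  epi_g := (ModuleCat.epi_iff_surjective _).2 hp

lemma exists_free_presentation [IsNoetherianRing Λ] (N : ModuleCat.{u} Λ) [Module.Finite Λ N] :
    ∃ (m : ℕ) (p : ModuleCat.of Λ (Fin m → Λ) ⟶ N), Function.Surjective p.hom ∧
      Module.Finite Λ (LinearMap.ker p.hom) := by
  obtain ⟨m, p, hp⟩ := Module.Finite.exists_fin' Λ N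
  exact ⟨m, ModuleCat.ofHom p, hp, inferInstance⟩

/-- The identity of `Λᵐ` is the sum of the projections to its factors. -/
lemma id_free_eq_sum (m : ℕ) : 𝟙 (ModuleCat.of Λ (Fin m → Λ)) =
    ∑ t, (ModuleCat.ofHom (LinearMap.proj t) : ModuleCat.of Λ (Fin m → Λ) ⟶ ModuleCat.of Λ Λ) ≫
      ModuleCat.ofHom (LinearMap.single Λ (fun _ => Λ) t) := by
  ext x
  simp [ModuleCat.hom_sum]

end Presentation

/-! ### Vanishing of morphisms tested on `Λ/𝔯` and on `Λ`. -/

namespace BoundedDerivedCategory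

open Pretriangulated

variable {Λ : Type u} [Ring Λ] [HasDerivedCategory.{w} (ModuleCat.{u} Λ)]

lemma eq_zero_of_free {K : BoundedDerivedCategory Λ} {i : ℤ}
    (h : ∀ g : ShiftedHom K (ofModule (ModuleCat.of Λ Λ)) i, g = 0) (m : ℕ)
    (g : ShiftedHom K (ofModule (ModuleCat.of Λ (Fin m → Λ))) i) : g = 0 := by
  have h1 := congrArg mapModule (id_free_eq_sum (Λ := Λ) m)
  rw [mapModule_id, mapModule_sum] at h1
  have h2 : g ≫ (𝟙 (ofModule (ModuleCat.of Λ (Fin m → Λ))))⟦i⟧' = g := by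
    rw [CategoryTheory.Functor.map_id, Category.comp_id]
  rw [← h2, h1, Functor.map_sum, Preadditive.comp_sum]
  refine Finset.sum_eq_zero fun t _ => ?_
  rw [mapModule_comp, Functor.map_comp, ← Category.assoc,
    h (g ≫ (mapModule (ModuleCat.ofHom (LinearMap.proj t)))⟦i⟧'), Limits.zero_comp]

section

variable [IsArtinianRing Λ]

/-- Only exactness at the middle term is needed, so vanishing in a single degree passes through
extensions. -/
lemma eq_zero_of_fg_left {Y : BoundedDerivedCategory Λ} {i : ℤ}
    (h : ∀ g : ShiftedHom (ofModule (ModuleCat.of Λ (Λ ⧸ Ring.jacobson Λ))) Y i, g = 0)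
    (M : ModuleCat.{u} Λ) [Module.Finite Λ M] : ∀ g : ShiftedHom (ofModule M) Y i, g = 0 := by
  refine fg_induction
    (Q := fun M => ∀ [Module.Finite Λ M], ∀ g : ShiftedHom (ofModule M) Y i, g = 0)
    h (fun {M N} _ _ r hM _ g => ?_) (fun {S} hS _ _ _ h₁ h₃ _ g => ?_) M
  · rw [← Category.id_comp g, ← (retractOfModule r).retract, Category.assoc,
      hM ((retractOfModule r).r ≫ g), Limits.comp_zero]
  · obtain ⟨δ, hD⟩ := exists_distTriang hS
    obtain ⟨v, rfl⟩ : ∃ v, g = mapModule S.g ≫ v := Triangle.yoneda_exact₂ _ hD g (h₁ _)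
    rw [h₃ v, Limits.comp_zero]

lemma eq_zero_of_fg_right {X : BoundedDerivedCategory Λ} {i : ℤ}
    (h : ∀ g : ShiftedHom X (ofModule (ModuleCat.of Λ (Λ ⧸ Ring.jacobson Λ))) i, g = 0)
    (M : ModuleCat.{u} Λ) [Module.Finite Λ M] : ∀ g : ShiftedHom X (ofModule M) i, g = 0 := by
  refine fg_induction
    (Q := fun M => ∀ [Module.Finite Λ M], ∀ g : ShiftedHom X (ofModule M) i, g = 0)
    h (fun {M N} _ _ r hM _ g => ?_) (fun {S} hS _ _ _ h₁ h₃ _ g => ?_) M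
  · rw [← Category.comp_id g, ← CategoryTheory.Functor.map_id, ← (retractOfModule r).retract,
      Functor.map_comp, ← Category.assoc, hM (g ≫ (retractOfModule r).i⟦i⟧'), Limits.zero_comp]
  · obtain ⟨δ, hD⟩ := exists_distTriang hS
    obtain ⟨v, rfl⟩ : ∃ v, v ≫ (mapModule S.f)⟦i⟧' = g :=
      CentralAction.coyoneda_exact₂_shift hD i g (h₃ _)
    rw [h₁ v, Limits.zero_comp]

/-- If `Hom(K, Σⁱ(Λ/𝔯)) = 0` for `i ≫ 0` and `Hom(K, ΣⁱΛ) = 0` for `i > a`, then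
`Hom(K, ΣⁱN) = 0` for `i > a` and all finitely generated modules `N`. -/
lemma eq_zero_of_eventually {K : BoundedDerivedCategory Λ}
    (hK : ∃ n : ℤ, ∀ i ≥ n,
      ∀ g : ShiftedHom K (ofModule (ModuleCat.of Λ (Λ ⧸ Ring.jacobson Λ))) i, g = 0) {a : ℤ}
    (ha : ∀ i > a, ∀ g : ShiftedHom K (ofModule (ModuleCat.of Λ Λ)) i, g = 0)
    (N : ModuleCat.{u} Λ) [Module.Finite Λ N] :
    ∀ i > a, ∀ g : ShiftedHom K (ofModule N) i, g = 0 := by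
  obtain ⟨b, hb⟩ := hK
  -- Descending induction on the degree, simultaneously for all `N`: with `Hom(K, ΣⁱΛᵐ) = 0`, degree
  -- `i` for `N` embeds into degree `i + 1` for the kernel of `Λᵐ ⟶ N`.
  have key : ∀ k : ℕ, ∀ (N : ModuleCat.{u} Λ) [Module.Finite Λ N], ∀ i > a, b - k ≤ i →
      ∀ g : ShiftedHom K (ofModule N) i, g = 0 := by
    intro k
    induction k with
    | zero => intro N _ i _ hi; exact eq_zero_of_fg_right (hb i (by simpa using hi)) N
    | succ k ih =>
      intro N _ i hia hi g
      obtain ⟨m, p, hp, hfin⟩ := exists_free_presentation N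
      have : Module.Finite Λ (kerShortComplex p).X₁ := hfin
      have : Module.Finite Λ (kerShortComplex p).X₂ :=
        inferInstanceAs (Module.Finite Λ (Fin m → Λ))
      have : Module.Finite Λ (kerShortComplex p).X₃ := inferInstanceAs (Module.Finite Λ N)
      obtain ⟨δ, hD⟩ := exists_distTriang (kerShortComplex_shortExact p hp)
      have h0 : g ≫ δ⟦i⟧' = 0 := by
        have h1 := ih (kerShortComplex p).X₁ (i + 1) (by omega) (by push_cast at hi; omega)
          (g ≫ δ⟦i⟧' ≫ (shiftFunctorAdd' _ 1 i (i + 1) (add_comm 1 i)).inv.app _)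
        rw [← Category.assoc] at h1
        rw [← cancel_mono ((shiftFunctorAdd' _ 1 i (i + 1) (add_comm 1 i)).inv.app _), h1,
          Limits.zero_comp]
      obtain ⟨v, rfl⟩ : ∃ v, v ≫ (mapModule p)⟦i⟧' = g :=
        CentralAction.coyoneda_exact₂_shift (rot_of_distTriang _ hD) i g h0
      rw [eq_zero_of_free (ha i hia) m v, Limits.zero_comp]
  intro i hi
  exact key (b - i).toNat N i hi (by have := Int.self_le_toNat (b - i); omega)

end

end BoundedDerivedCategory

/-! ### The gap theorem and the vanishing of `Extⁱ(-, Λ)`. -/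

namespace CentralAction

open BoundedDerivedCategory Pretriangulated

variable {Λ : Type u} [Ring Λ] [HasDerivedCategory.{w} (ModuleCat.{u} Λ)] [IsArtinianRing Λ]
  {R : Type*} [Ring R] {𝒜 : ℕ → AddSubgroup R} [GradedRing 𝒜]
  {act : CentralAction (BoundedDerivedCategory Λ) 𝒜}

lemma EventuallyNoetherian.of_fg (h : act.EventuallyNoetherian
      (ofModule (ModuleCat.of Λ (Λ ⧸ Ring.jacobson Λ)))
      (ofModule (ModuleCat.of Λ (Λ ⧸ Ring.jacobson Λ))))
    (M N : ModuleCat.{u} Λ) [Module.Finite Λ M] [Module.Finite Λ N] :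
    act.EventuallyNoetherian (ofModule M) (ofModule N) := by
  have h1 : act.EventuallyNoetherian (ofModule M)
      (ofModule (ModuleCat.of Λ (Λ ⧸ Ring.jacobson Λ))) := by
    refine fg_induction (Q := fun M => ∀ [Module.Finite Λ M], act.EventuallyNoetherian (ofModule M)
      (ofModule (ModuleCat.of Λ (Λ ⧸ Ring.jacobson Λ)))) h
      (fun _ _ r hM _ => hM.of_retract_left (retractOfModule r))
      (fun {S} hS _ _ _ h₁ h₃ _ => ?_) M
    obtain ⟨δ, hD⟩ := exists_distTriang hS
    exact EventuallyNoetherian.of_distTriang_left hD h₁ h₃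
  refine fg_induction (Q := fun N => ∀ [Module.Finite Λ N],
      act.EventuallyNoetherian (ofModule M) (ofModule N)) h1
      (fun _ _ r hM _ => hM.of_retract_right (retractOfModule r))
      (fun {S} hS _ _ _ h₁ h₃ _ => ?_) N
  obtain ⟨δ, hD⟩ := exists_distTriang hS
  exact EventuallyNoetherian.of_distTriang_right hD h₁ h₃

variable (hR : IsGradedCommutative 𝒜) (h : act.EventuallyNoetherian
      (ofModule (ModuleCat.of Λ (Λ ⧸ Ring.jacobson Λ)))
      (ofModule (ModuleCat.of Λ (Λ ⧸ Ring.jacobson Λ))))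

include hR h in
/-- The gap theorem: if `Extⁱ(M, Λ) = 0` for `i > a` and `Extⁱ(M, N) = 0` for `i ≫ 0`, then
`Extⁱ(M, N) = 0` for `i > a`. -/
theorem subsingleton_ext_of_eventually (M N : ModuleCat.{u} Λ) [Module.Finite Λ M]
    [Module.Finite Λ N] {a : ℕ}
    (ha : ∀ i : ℕ, a < i → Subsingleton (Ext.{u} M (ModuleCat.of Λ Λ) i))
    (hN : ∃ n : ℕ, ∀ i : ℕ, n ≤ i → Subsingleton (Ext.{u} M N i)) :
    ∀ i : ℕ, a < i → Subsingleton (Ext.{u} M N i) := by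
  have key := EventuallyNoetherian.cone_induction hR (h.of_fg M M)
    (h.of_fg M (ModuleCat.of Λ (Λ ⧸ Ring.jacobson Λ)))
    -- The bound is quantified inside because passing to the cone of a degree `n` element replaces
    -- `a` by `a + n`.
    (Q := fun X => ∀ a : ℤ, (∀ i > a, ∀ g : ShiftedHom X (ofModule (ModuleCat.of Λ Λ)) i, g = 0) →
      (∃ n : ℤ, ∀ i ≥ n, ∀ g : ShiftedHom X (ofModule N) i, g = 0) →
      ∀ i > a, ∀ g : ShiftedHom X (ofModule N) i, g = 0)
    (fun K hK a ha _ => eq_zero_of_eventually hK ha N)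
    (fun X K n hn r j p hD hK a ha hN => by
      obtain ⟨b, hb⟩ := hN
      refine ShiftedHom.eq_zero_of_cone_eq_zero hD hn
        (hK (a + n) (ShiftedHom.eq_zero_of_cone hD hn ha) ⟨b + n, fun i hi => ?_⟩) ⟨b, hb⟩
      exact ShiftedHom.eq_zero_of_cone hD hn (a := b - 1) (fun i hi => hb i (by omega)) i (by omega))
  obtain ⟨n, hn⟩ := hN
  intro i hi
  refine (subsingleton_ext_iff i).2 (key a (fun i hi => ?_) ⟨n, fun i hi => ?_⟩ i (by omega))
  · obtain ⟨k, rfl⟩ := Int.eq_ofNat_of_zero_le (show 0 ≤ i by omega)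
    exact (subsingleton_ext_iff k).1 (ha k (by omega))
  · obtain ⟨k, rfl⟩ := Int.eq_ofNat_of_zero_le (show 0 ≤ i by omega)
    exact (subsingleton_ext_iff k).1 (hn k (by omega))

include h in
-- Elements of degree `≥ 1` act on `Ext*(Λ/𝔯, Λ)` through `Ext^{>0}(Λ, Λ) = 0`, so eventual
-- Noetherianity leaves only finitely many nonzero nonnegative degrees. The bound for `Λ/𝔯` then
-- serves all finitely generated `M`.
lemma exists_subsingleton_ext_self : ∃ n : ℕ, ∀ i ≥ n, ∀ (M : ModuleCat.{u} Λ) [Module.Finite Λ M],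
    Subsingleton (Ext.{u} M (ModuleCat.of Λ Λ) i) := by
  obtain ⟨n, hn⟩ := (h.of_fg (ModuleCat.of Λ (Λ ⧸ Ring.jacobson Λ))
    (ModuleCat.of Λ Λ)).exists_forall_eq_zero 0 (fun i _ g => ⟨1, fun m hm r hr => by
      obtain ⟨m, rfl⟩ := Nat.exists_eq_add_of_le' hm
      have : Projective (ModuleCat.of Λ Λ) := ModuleCat.projective_of_categoryTheory_projective _
      have h0 := (subsingleton_ext_iff (m + 1)).1
        (Ext.subsingleton_of_projective (ModuleCat.of Λ Λ) (ModuleCat.of Λ Λ) m)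
        (centerApp (act.toCenter (m + 1) ⟨r, hr⟩) _)
      rw [HomStar.smul_of ⟨r, hr⟩ g rfl, h0, ShiftedHom.comp_zero]
      exact map_zero _⟩)
  refine ⟨n.toNat, fun i hi M _ => (subsingleton_ext_iff i).2 ?_⟩
  exact eq_zero_of_fg_left (hn i (by omega)) M

end CentralAction

/-! ### Extensions of maps and injective dimension -/

section InjectiveDimension

variable {Λ : Type u} [Ring Λ]

/-- A map extends along a monomorphism if `Ext¹` from the cokernel vanishes. -/
lemma exists_extension_of_ext_one {S : ShortComplex (ModuleCat.{u} Λ)} (hS : S.ShortExact)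
    {Y : ModuleCat.{u} Λ} (h : Subsingleton (Ext.{u} S.X₃ Y 1)) (f : S.X₁ ⟶ Y) :
    ∃ g : S.X₂ ⟶ Y, S.f ≫ g = f := by
  obtain ⟨x, hx⟩ := Ext.contravariant_sequence_exact₁ hS Y (Ext.mk₀ f) (add_zero 1)
    (Subsingleton.elim _ _)
  obtain ⟨g, rfl⟩ := (Ext.mk₀_bijective S.X₂ Y).2 x
  rw [Ext.mk₀_comp_mk₀] at hx
  exact ⟨g, (Ext.mk₀_bijective S.X₁ Y).1 hx⟩

/-- `Ext¹(X₃, Y)` vanishes if all maps `X₁ ⟶ Y` factor through modules `Q` with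
`Ext¹(X₃, Q) = 0`. -/
lemma subsingleton_ext_one_of_factors {S : ShortComplex (ModuleCat.{u} Λ)} (hS : S.ShortExact)
    {Y : ModuleCat.{u} Λ} (h₂ : Subsingleton (Ext.{u} S.X₂ Y 1))
    (h : ∀ f : S.X₁ ⟶ Y, ∃ (Q : ModuleCat.{u} Λ) (a : S.X₁ ⟶ Q) (b : Q ⟶ Y),
      Subsingleton (Ext.{u} S.X₃ Q 1) ∧ a ≫ b = f) : Subsingleton (Ext.{u} S.X₃ Y 1) := by
  refine subsingleton_of_forall_eq 0 fun x => ?_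
  -- Every class is the extension class of `S` pushed out along a map `X₁ ⟶ Y`; factoring that map
  -- through `Q` makes the class pass through `Ext¹(X₃, Q) = 0`.
  obtain ⟨y, rfl⟩ := Ext.contravariant_sequence_exact₃ hS Y x (h₂.elim _ _) (add_zero 1)
  obtain ⟨f, rfl⟩ := (Ext.mk₀_bijective S.X₁ Y).2 y
  obtain ⟨Q, a, b, hQ, rfl⟩ := h f
  rw [← Ext.mk₀_comp_mk₀, ← Ext.comp_assoc_of_third_deg_zero,
    hQ.elim (hS.extClass.comp (Ext.mk₀ a) (add_zero 1)) 0, Ext.zero_comp]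

section ShortExact

variable {S : ShortComplex (ModuleCat.{u} Λ)} (hS : S.ShortExact) {Y : ModuleCat.{u} Λ} {i : ℕ}

include hS

lemma subsingleton_ext_X₃_left (h₁ : Subsingleton (Ext.{u} S.X₁ Y i))
    (h₂ : Subsingleton (Ext.{u} S.X₂ Y (i + 1))) : Subsingleton (Ext.{u} S.X₃ Y (i + 1)) := by
  refine subsingleton_of_forall_eq 0 fun x => ?_
  obtain ⟨y, rfl⟩ := Ext.contravariant_sequence_exact₃ hS Y x (h₂.elim _ _) (add_comm 1 i)
  rw [h₁.elim y 0, Ext.comp_zero]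

lemma subsingleton_ext_X₁_left (h₂ : Subsingleton (Ext.{u} S.X₂ Y i))
    (h₃ : Subsingleton (Ext.{u} S.X₃ Y (i + 1))) : Subsingleton (Ext.{u} S.X₁ Y i) := by
  refine subsingleton_of_forall_eq 0 fun x => ?_
  obtain ⟨y, rfl⟩ := Ext.contravariant_sequence_exact₁ hS Y x (add_comm 1 i) (h₃.elim _ _)
  rw [h₂.elim y 0, Ext.comp_zero]

lemma subsingleton_ext_X₁_right (h₃ : Subsingleton (Ext.{u} Y S.X₃ i))
    (h₂ : Subsingleton (Ext.{u} Y S.X₂ (i + 1))) : Subsingleton (Ext.{u} Y S.X₁ (i + 1)) := by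
  refine subsingleton_of_forall_eq 0 fun x => ?_
  obtain ⟨y, rfl⟩ := Ext.covariant_sequence_exact₁ Y hS x (h₂.elim _ _) rfl
  rw [h₃.elim y 0, Ext.zero_comp]

lemma subsingleton_ext_X₃_right (h₂ : Subsingleton (Ext.{u} Y S.X₂ i))
    (h₁ : Subsingleton (Ext.{u} Y S.X₁ (i + 1))) : Subsingleton (Ext.{u} Y S.X₃ i) := by
  refine subsingleton_of_forall_eq 0 fun x => ?_
  obtain ⟨y, rfl⟩ := Ext.covariant_sequence_exact₃ Y hS x rfl (h₁.elim _ _)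
  rw [h₂.elim y 0, Ext.zero_comp]

end ShortExact

/-- Injectivity can be tested on `Ext¹` from finitely generated modules. -/
lemma injective_of_ext_one_fg (X : ModuleCat.{u} Λ)
    (h : ∀ (M : ModuleCat.{u} Λ) [Module.Finite Λ M], Subsingleton (Ext.{u} M X 1)) :
    Injective X := by
  have : Module.Injective Λ X := by
    refine Module.Baer.injective fun I g => ?_
    obtain ⟨g', hg'⟩ := exists_extension_of_ext_one (submoduleShortComplex_shortExact I)
      (h (ModuleCat.of Λ (Λ ⧸ I))) (ModuleCat.ofHom g)
    refine ⟨g'.hom, fun x hx => ?_⟩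
    exact congrArg (fun f : ModuleCat.of Λ I ⟶ X => f.hom ⟨x, hx⟩) hg'
  exact Module.injective_object_of_injective_module Λ X

/-- Dimension shifting along an embedding into an injective reduces to `n = 0`, which is Baer's
criterion. -/
lemma hasInjectiveDimensionLT_of_fg (n : ℕ) (X : ModuleCat.{u} Λ)
    (h : ∀ (M : ModuleCat.{u} Λ) [Module.Finite Λ M], Subsingleton (Ext.{u} M X (n + 1))) :
    HasInjectiveDimensionLT X (n + 1) := by
  induction n generalizing X with
  | zero =>
    have := injective_of_ext_one_fg X h
    infer_instance
  | succ n ih =>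
    have hS : (ShortComplex.mk (Injective.ι X) _ (Limits.cokernel.condition _)).ShortExact :=
      { exact := ShortComplex.exact_cokernel _ }
    refine (hS.hasInjectiveDimensionLT_X₃_iff n (inferInstanceAs (Injective (Injective.under X)))).1
      (ih _ fun M _ => ?_)
    exact subsingleton_ext_X₃_right hS (HasInjectiveDimensionLT.subsingleton
      (Injective.under X) 1 (n + 1) (by omega) M) (h M)

end InjectiveDimension

/-! ### Syzygies and extension groups -/

section Syzygy

variable {Λ : Type u} [Ring Λ]

/-- Vanishing of `Extⁱ(Z, Λ)` implies that of `Extⁱ(Z, P)` for finitely generated projective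
modules `P`. -/
lemma subsingleton_ext_of_projective_right {Z : ModuleCat.{u} Λ} {i : ℕ}
    (h : Subsingleton (Ext.{u} Z (ModuleCat.of Λ Λ) i)) (P : ModuleCat.{u} Λ) [Module.Finite Λ P]
    (hP : Module.Projective Λ P) : Subsingleton (Ext.{u} Z P i) := by
  obtain ⟨m, p, hp⟩ := Module.Finite.exists_fin' Λ P
  obtain ⟨s, hs⟩ := Module.projective_lifting_property p LinearMap.id hp
  refine subsingleton_of_forall_eq 0 fun x => ?_
  -- The identity of `P` is a finite sum of maps factoring through `Λ`, so every class is a sum of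
  -- images of classes in `Extⁱ(Z, Λ)`.
  have hid : 𝟙 P = (ModuleCat.ofHom s : P ⟶ ModuleCat.of Λ (Fin m → Λ)) ≫
      𝟙 (ModuleCat.of Λ (Fin m → Λ)) ≫ ModuleCat.ofHom p := by
    rw [Category.id_comp, ← ModuleCat.ofHom_comp, hs]
    rfl
  rw [id_free_eq_sum, Preadditive.sum_comp, Preadditive.comp_sum] at hid
  rw [← Ext.comp_mk₀_id x, hid, Ext.mk₀_sum, Ext.comp_sum]
  refine Finset.sum_eq_zero fun t _ => ?_
  rw [← Category.assoc, ← Category.assoc, Category.assoc, ← Ext.mk₀_comp_mk₀,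
    ← Ext.comp_assoc_of_third_deg_zero,
    h.elim (x.comp (Ext.mk₀ (ModuleCat.ofHom s ≫ ModuleCat.ofHom (LinearMap.proj t))) _) 0,
    Ext.zero_comp]

variable [IsNoetherianRing Λ]

namespace ProjPres

variable {X : FGModuleCat.{u} Λ} (A : ProjPres X)

omit [IsNoetherianRing Λ] in
lemma shortExact : (kerShortComplex A.p.hom).ShortExact :=
  kerShortComplex_shortExact A.p.hom A.surj

omit [IsNoetherianRing Λ] in
lemma projective_obj : Projective A.P.obj :=
  have := A.proj
  ModuleCat.projective_of_categoryTheory_projective _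

omit [IsNoetherianRing Λ] in
lemma subsingleton_ext_P (Y : ModuleCat.{u} Λ) {i : ℕ} (hi : 0 < i) :
    Subsingleton (Ext.{u} A.P.obj Y i) := by
  have := A.projective_obj
  exact HasProjectiveDimensionLT.subsingleton A.P.obj 1 i hi Y

lemma subsingleton_ext_succ {Y : ModuleCat.{u} Λ} {i : ℕ}
    (h : Subsingleton (Ext.{u} A.ker.obj Y i)) : Subsingleton (Ext.{u} X.obj Y (i + 1)) :=
  subsingleton_ext_X₃_left A.shortExact h (A.subsingleton_ext_P Y (by omega))

lemma subsingleton_ext_ker {Y : ModuleCat.{u} Λ} {i : ℕ} (hi : 0 < i)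
    (h : Subsingleton (Ext.{u} X.obj Y (i + 1))) : Subsingleton (Ext.{u} A.ker.obj Y i) :=
  subsingleton_ext_X₁_left A.shortExact (A.subsingleton_ext_P Y hi) h

lemma subsingleton_ext_ker_right {Z : ModuleCat.{u} Λ} {i : ℕ}
    (hZ : Subsingleton (Ext.{u} Z (ModuleCat.of Λ Λ) (i + 1)))
    (h : Subsingleton (Ext.{u} Z X.obj i)) : Subsingleton (Ext.{u} Z A.ker.obj (i + 1)) :=
  subsingleton_ext_X₁_right A.shortExact h
    (subsingleton_ext_of_projective_right hZ A.P.obj A.proj)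

lemma subsingleton_ext_right {Z : ModuleCat.{u} Λ} {i : ℕ}
    (hZ : Subsingleton (Ext.{u} Z (ModuleCat.of Λ Λ) i))
    (h : Subsingleton (Ext.{u} Z A.ker.obj (i + 1))) : Subsingleton (Ext.{u} Z X.obj i) :=
  subsingleton_ext_X₃_right A.shortExact
    (subsingleton_ext_of_projective_right hZ A.P.obj A.proj) h

/-- A map from the syzygy of `X` to `Z` factors through a projective module if `Ext¹(X, Z) = 0`. -/
lemma factorsThroughProjective {Z : FGModuleCat.{u} Λ} (h : Subsingleton (Ext.{u} X.obj Z.obj 1))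
    (f : A.ker ⟶ Z) : FactorsThroughProjective f := by
  obtain ⟨g, hg⟩ := exists_extension_of_ext_one A.shortExact h f.hom
  exact ⟨A.P, A.ι, ObjectProperty.homMk g, A.proj, ObjectProperty.hom_ext _ hg⟩

/-- If `Ext¹(X, Λ) = 0` and all maps from the syzygy of `X` to `Z` factor through projective
modules, then `Ext¹(X, Z) = 0`. -/
lemma subsingleton_ext_one (hX : Subsingleton (Ext.{u} X.obj (ModuleCat.of Λ Λ) 1))
    {Z : FGModuleCat.{u} Λ} (h : ∀ f : A.ker ⟶ Z, FactorsThroughProjective f) :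
    Subsingleton (Ext.{u} X.obj Z.obj 1) := by
  refine subsingleton_ext_one_of_factors A.shortExact (A.subsingleton_ext_P Z.obj one_pos)
    fun f => ?_
  obtain ⟨Q, a, b, hQ, hab⟩ := h (ObjectProperty.homMk f)
  exact ⟨Q.obj, a.hom, b.hom, subsingleton_ext_of_projective_right hX Q.obj hQ,
    congrArg (fun φ => φ.hom) hab⟩

end ProjPres

/-- The syzygy of a finitely generated module. -/
noncomputable def syzygy (X : FGModuleCat.{u} Λ) : FGModuleCat.{u} Λ :=
  (projPres X).ker

lemma subsingleton_ext_add (n : ℕ) {X : FGModuleCat.{u} Λ} {Y : ModuleCat.{u} Λ} {i : ℕ}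
    (h : Subsingleton (Ext.{u} (syzygy^[n] X).obj Y i)) :
    Subsingleton (Ext.{u} X.obj Y (i + n)) := by
  induction n generalizing i with
  | zero => exact h
  | succ n ih =>
    rw [Function.iterate_succ_apply'] at h
    have := ih ((projPres _).subsingleton_ext_succ h)
    rwa [add_right_comm] at this

lemma subsingleton_ext_syzygy (n : ℕ) {X : FGModuleCat.{u} Λ} {Y : ModuleCat.{u} Λ} {i : ℕ}
    (hi : 0 < i) (h : Subsingleton (Ext.{u} X.obj Y (i + n))) :
    Subsingleton (Ext.{u} (syzygy^[n] X).obj Y i) := by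
  induction n generalizing i with
  | zero => exact h
  | succ n ih =>
    rw [Function.iterate_succ_apply']
    refine (projPres _).subsingleton_ext_ker hi (ih (by omega) ?_)
    rwa [add_right_comm]

/-- Eventual vanishing of `Extⁱ(Z, X)` passes to the syzygies of `X`. -/
lemma eventually_ext_syzygy_right {Z : ModuleCat.{u} Λ}
    (hZ : ∃ m : ℕ, ∀ i, m ≤ i → Subsingleton (Ext.{u} Z (ModuleCat.of Λ Λ) i)) (n : ℕ)
    {X : FGModuleCat.{u} Λ} (h : ∃ m : ℕ, ∀ i, m ≤ i → Subsingleton (Ext.{u} Z X.obj i)) :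
    ∃ m : ℕ, ∀ i, m ≤ i → Subsingleton (Ext.{u} Z (syzygy^[n] X).obj i) := by
  obtain ⟨l, hl⟩ := hZ
  induction n with
  | zero => exact h
  | succ n ih =>
    obtain ⟨m, hm⟩ := ih
    refine ⟨max l m + 1, fun i hi => ?_⟩
    obtain ⟨i, rfl⟩ := Nat.exists_eq_succ_of_ne_zero (show i ≠ 0 by omega)
    rw [Function.iterate_succ_apply']
    exact (projPres _).subsingleton_ext_ker_right (hl _ (by omega)) (hm i (by omega))

/-- Eventual vanishing of `Extⁱ(Z, ΩⁿX)` passes to `X`. -/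
lemma eventually_ext_of_syzygy_right {Z : ModuleCat.{u} Λ}
    (hZ : ∃ m : ℕ, ∀ i, m ≤ i → Subsingleton (Ext.{u} Z (ModuleCat.of Λ Λ) i)) (n : ℕ)
    {X : FGModuleCat.{u} Λ}
    (h : ∃ m : ℕ, ∀ i, m ≤ i → Subsingleton (Ext.{u} Z (syzygy^[n] X).obj i)) :
    ∃ m : ℕ, ∀ i, m ≤ i → Subsingleton (Ext.{u} Z X.obj i) := by
  obtain ⟨l, hl⟩ := hZ
  induction n with
  | zero => exact h
  | succ n ih =>
    obtain ⟨m, hm⟩ := h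
    refine ih ⟨max l m, fun i hi => ?_⟩
    refine (projPres _).subsingleton_ext_right (hl i (by omega)) ?_
    have := hm (i + 1) (by omega)
    rwa [Function.iterate_succ_apply'] at this

end Syzygy

/-! ### Suspensions of syzygies -/

section StableCategory

variable {Λ : Type u} [Ring Λ]

lemma stableFunctor_map_eq_zero_iff {X Y : FGModuleCat.{u} Λ} (f : X ⟶ Y) :
    (CategoryTheory.Quotient.functor (stableRel Λ)).map f = 0 ↔ FactorsThroughProjective f := by
  rw [← Functor.map_zero (CategoryTheory.Quotient.functor (stableRel Λ)) X Y,
    CategoryTheory.Quotient.functor_map_eq_iff]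
  change FactorsThroughProjective (f - 0) ↔ _
  rw [sub_zero]

/-- The cokernel of a left approximation is unique in the stable category. -/
lemma LeftApprox.nonempty_iso_coker {X : FGModuleCat.{u} Λ} (A B : LeftApprox X) :
    Nonempty ((CategoryTheory.Quotient.functor (stableRel Λ)).obj A.coker ≅
      (CategoryTheory.Quotient.functor (stableRel Λ)).obj B.coker) := by
  obtain ⟨f, hf⟩ := A.exists_induced B (𝟙 X)
  obtain ⟨g, hg⟩ := B.exists_induced A (𝟙 X)
  refine ⟨⟨(CategoryTheory.Quotient.functor _).map f, (CategoryTheory.Quotient.functor _).map g,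
    ?_, ?_⟩⟩
  · rw [← Functor.map_comp, ← CategoryTheory.Functor.map_id]
    exact (hf.comp hg).sound (f' := 𝟙 X) ⟨𝟙 _, by simp, by simp⟩ (by
      rw [Category.comp_id]; exact Congruence.equivalence.refl _)
  · rw [← Functor.map_comp, ← CategoryTheory.Functor.map_id]
    exact (hg.comp hf).sound (f' := 𝟙 X) ⟨𝟙 _, by simp, by simp⟩ (by
      rw [Category.comp_id]; exact Congruence.equivalence.refl _)

variable [IsNoetherianRing Λ]

/-- If `Ext¹(X, Λ) = 0`, the inclusion of the syzygy of `X` is a left approximation. -/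
noncomputable def ProjPres.leftApprox {X : FGModuleCat.{u} Λ} (A : ProjPres X)
    (hX : Subsingleton (Ext.{u} X.obj (ModuleCat.of Λ Λ) 1)) : LeftApprox A.ker where
  P := A.P
  proj := A.proj
  i := A.ι
  fac Q hQ f := by
    obtain ⟨g, hg⟩ := exists_extension_of_ext_one A.shortExact
      (subsingleton_ext_of_projective_right hX Q.obj hQ) f.hom
    exact ⟨ObjectProperty.homMk g, ObjectProperty.hom_ext _ hg⟩

lemma ProjPres.nonempty_coker_iso {X : FGModuleCat.{u} Λ} (A : ProjPres X)
    (hX : Subsingleton (Ext.{u} X.obj (ModuleCat.of Λ Λ) 1)) :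
    Nonempty ((A.leftApprox hX).coker ≅ X) := by
  have h : LinearMap.range A.ι.hom.hom = LinearMap.ker A.p.hom.hom := Submodule.range_subtype _
  exact ⟨ObjectProperty.isoMk _ ((Submodule.quotEquivOfEq _ _ h).trans
    (A.p.hom.hom.quotKerEquivOfSurjective A.surj)).toModuleIso⟩

variable (k : Type*) [CommRing k] [IsArtinianRing k] [Algebra k Λ] [Module.Finite k Λ]

/-- The inclusion of the syzygy into the projective cover term is itself a left approximation with
cokernel `X`, and cokernels of left approximations agree stably. -/
lemma nonempty_stableSuspension_syzygy_iso {X : FGModuleCat.{u} Λ}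
    (hX : Subsingleton (Ext.{u} X.obj (ModuleCat.of Λ Λ) 1)) :
    Nonempty ((stableSuspension Λ k).obj ⟨syzygy X⟩ ≅ ⟨X⟩) := by
  obtain ⟨e⟩ := (leftApprox k (syzygy X)).nonempty_iso_coker ((projPres X).leftApprox hX)
  obtain ⟨e'⟩ := (projPres X).nonempty_coker_iso hX
  exact ⟨e ≪≫ (CategoryTheory.Quotient.functor (stableRel Λ)).mapIso e'⟩

lemma nonempty_functorPow_stableSuspension_iso {X : FGModuleCat.{u} Λ}
    (hX : ∀ i : ℕ, 0 < i → Subsingleton (Ext.{u} X.obj (ModuleCat.of Λ Λ) i)) (n m : ℕ) :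
    Nonempty ((functorPow (stableSuspension Λ k) n).obj ⟨syzygy^[n + m] X⟩ ≅ ⟨syzygy^[m] X⟩) := by
  induction n generalizing m with
  | zero => rw [zero_add]; exact ⟨Iso.refl _⟩
  | succ n ih =>
    obtain ⟨e⟩ := ih (m + 1)
    rw [show n + 1 + m = n + (m + 1) by omega]
    rw [Function.iterate_succ_apply' _ m] at e
    obtain ⟨e'⟩ := nonempty_stableSuspension_syzygy_iso k
      (subsingleton_ext_syzygy m one_pos (hX (1 + m) (by omega)))
    exact ⟨(stableSuspension Λ k).mapIso e ≪≫ e'⟩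

lemma functorPow_stableSyzygy_obj (X : FGModuleCat.{u} Λ) (n : ℕ) :
    (functorPow (stableSyzygy Λ) n).obj ⟨X⟩ = ⟨syzygy^[n] X⟩ := by
  induction n with
  | zero => rfl
  | succ n ih =>
    rw [Function.iterate_succ_apply']
    change (stableSyzygy Λ).obj ((functorPow (stableSyzygy Λ) n).obj ⟨X⟩) = _
    rw [ih]
    rfl

/-- `Σᵈ` shifts the syzygies of a maximal Cohen-Macaulay module. -/
lemma nonempty_stableShift_syzygy_iso {X : FGModuleCat.{u} Λ}
    (hX : ∀ i : ℕ, 0 < i → Subsingleton (Ext.{u} X.obj (ModuleCat.of Λ Λ) i)) (d : ℤ) (i : ℕ)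
    (hi : d ≤ i) : ∃ j : ℕ, Nonempty ((stableShift Λ k d).obj ⟨syzygy^[i] X⟩ ≅ ⟨syzygy^[j] X⟩) := by
  cases d with
  | ofNat n =>
    obtain ⟨j, rfl⟩ := Nat.exists_eq_add_of_le (show n ≤ i from Int.ofNat_le.1 hi)
    exact ⟨j, nonempty_functorPow_stableSuspension_iso k hX n j⟩
  | negSucc n =>
    -- For `d = -(n + 1)` the shift adds `n + 1` further syzygies.
    refine ⟨n + 1 + i, ⟨eqToIso ?_⟩⟩
    rw [Function.iterate_add_apply]
    exact functorPow_stableSyzygy_obj _ (n + 1)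

variable {k}

/-- Over a stably symmetric algebra, vanishing of the stable homomorphisms from `X` to the syzygies
of `Y` implies vanishing of those from high syzygies of `Y` to `X`. -/
lemma IsStablySymmetric.factorsThroughProjective {E : Type*} [AddCommGroup E] [Module k E]
    (hΛ : IsStablySymmetric Λ k E) {X Y : FGModuleCat.{u} Λ}
    (hX : ∀ i : ℕ, 0 < i → Subsingleton (Ext.{u} X.obj (ModuleCat.of Λ Λ) i))
    (hY : ∀ i : ℕ, 0 < i → Subsingleton (Ext.{u} Y.obj (ModuleCat.of Λ Λ) i))
    (h : ∀ (j : ℕ) (f : X ⟶ syzygy^[j] Y), FactorsThroughProjective f) :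
    ∃ n : ℕ, ∀ i : ℕ, n ≤ i → ∀ f : syzygy^[i] Y ⟶ X, FactorsThroughProjective f := by
  obtain ⟨d, F, ⟨e⟩⟩ := hΛ
  -- From `i ≥ d` on, `Σᵈ` of the `i`-th syzygy is still a syzygy of `Y`, so the hypothesis on maps
  -- out of `X` applies to it.
  refine ⟨d.toNat, fun i hi f => ?_⟩
  let X' : StableMCM Λ := ⟨⟨X⟩, hX⟩
  let Y' : StableMCM Λ := ⟨⟨syzygy^[i] Y⟩, fun l hl =>
    subsingleton_ext_syzygy i hl (hY (l + i) (by omega))⟩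
  obtain ⟨j, ⟨e'⟩⟩ := nonempty_stableShift_syzygy_iso k hY d i (by omega)
  have h0 : ∀ g : X' ⟶ F.S.obj Y', g = 0 := by
    intro g
    refine ObjectProperty.hom_ext _ ?_
    rw [← cancel_mono (e.hom.app Y'), ← cancel_mono e'.hom]
    obtain ⟨φ, hφ⟩ := (CategoryTheory.Quotient.functor (stableRel Λ)).map_surjective
      (X := X) (Y := syzygy^[j] Y) ((g.hom ≫ e.hom.app Y') ≫ e'.hom)
    refine hφ.symm.trans ?_
    rw [(stableFunctor_map_eq_zero_iff φ).2 (h j φ)]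
    exact (by simp : (0 : X'.obj ⟶ _) = ((0 : X'.obj ⟶ (F.S.obj Y').obj) ≫ e.hom.app Y') ≫ e'.hom)
  let f' : Y' ⟶ X' := ObjectProperty.homMk ((CategoryTheory.Quotient.functor (stableRel Λ)).map f)
  have hf' : f' = 0 := by
    -- `Hom(Y', X')` is dual to `Hom(X', S Y')`, which is zero by `h0`.
    refine (F.duality Y' X').injective (LinearMap.ext fun g => ?_)
    rw [h0 g, map_zero, map_zero]
  exact (stableFunctor_map_eq_zero_iff f).1 (congrArg (fun φ => φ.hom) hf')

end StableCategory

/-! ### Symmetry of the vanishing of cohomology -/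

section Symmetry

open BoundedDerivedCategory CentralAction

variable {Λ : Type u} [Ring Λ] [HasDerivedCategory.{w} (ModuleCat.{u} Λ)]
  {R : Type*} [Ring R] {𝒜 : ℕ → AddSubgroup R} [GradedRing 𝒜]
  {act : CentralAction (BoundedDerivedCategory Λ) 𝒜}

/-- The injective dimension of `Λ` is finite. -/
lemma CentralAction.exists_hasInjectiveDimensionLT [IsArtinianRing Λ]
    (h : act.EventuallyNoetherian (ofModule (ModuleCat.of Λ (Λ ⧸ Ring.jacobson Λ)))
      (ofModule (ModuleCat.of Λ (Λ ⧸ Ring.jacobson Λ)))) :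
    ∃ n : ℕ, HasInjectiveDimensionLT (ModuleCat.of Λ Λ) (n + 1) := by
  obtain ⟨n, hn⟩ := exists_subsingleton_ext_self h
  exact ⟨n, hasInjectiveDimensionLT_of_fg n _ fun M _ => hn (n + 1) (by omega) M⟩

/-- Eventual vanishing of `Extⁱ(M, N)` implies its vanishing above the injective dimension
of `Λ`. -/
lemma CentralAction.subsingleton_ext_of_injectiveDimension_lt [IsArtinianRing Λ]
    (hR : IsGradedCommutative 𝒜)
    (h : act.EventuallyNoetherian (ofModule (ModuleCat.of Λ (Λ ⧸ Ring.jacobson Λ)))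
      (ofModule (ModuleCat.of Λ (Λ ⧸ Ring.jacobson Λ))))
    (M N : ModuleCat.{u} Λ) [Module.Finite Λ M] [Module.Finite Λ N]
    (hN : ∃ n : ℕ, ∀ i : ℕ, n ≤ i → Subsingleton (Ext.{u} M N i)) {i : ℕ}
    (hi : injectiveDimension (ModuleCat.of Λ Λ) < (i : WithBot ℕ∞)) :
    Subsingleton (Ext.{u} M N i) := by
  have hd := injectiveDimension_lt_iff.1 hi
  cases i with
  -- Injective dimension below `0` means `Λ = 0`, so every module is zero.
  | zero =>
    have : Subsingleton Λ :=
      ModuleCat.subsingleton_of_isZero (isZero_of_hasInjectiveDimensionLT_zero (ModuleCat.of Λ Λ))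
    have : Subsingleton N := Module.subsingleton Λ N
    refine subsingleton_of_forall_eq 0 fun x => ?_
    rw [← Ext.comp_mk₀_id x, (ModuleCat.isZero_of_subsingleton N).eq_zero_of_src (𝟙 N),
      Ext.mk₀_zero, Ext.comp_zero]
  | succ a =>
    exact subsingleton_ext_of_eventually hR h M N (fun i hi =>
      HasInjectiveDimensionLT.subsingleton (ModuleCat.of Λ Λ) (a + 1) i hi M) hN (a + 1) (by omega)

variable {k : Type*} [CommRing k] [IsArtinianRing k] [Algebra k Λ] [Module.Finite k Λ]

/-- Over a stably symmetric algebra, eventual vanishing of `Extⁱ(M, N)` implies that of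
`Extⁱ(N, M)`. -/
lemma IsStablySymmetric.eventually_ext_symm [IsArtinianRing Λ] {E : Type*} [AddCommGroup E]
    [Module k E] (hΛ : IsStablySymmetric Λ k E) (hR : IsGradedCommutative 𝒜)
    (h : act.EventuallyNoetherian (ofModule (ModuleCat.of Λ (Λ ⧸ Ring.jacobson Λ)))
      (ofModule (ModuleCat.of Λ (Λ ⧸ Ring.jacobson Λ))))
    (M N : FGModuleCat.{u} Λ)
    (hMN : ∃ n : ℕ, ∀ i : ℕ, n ≤ i → Subsingleton (Ext.{u} M.obj N.obj i)) :
    ∃ n : ℕ, ∀ i : ℕ, n ≤ i → Subsingleton (Ext.{u} N.obj M.obj i) := by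
  obtain ⟨d, hd⟩ := exists_subsingleton_ext_self h
  have hMCM : ∀ (n : ℕ) (X : FGModuleCat.{u} Λ) (i : ℕ), 0 < i →
      Subsingleton (Ext.{u} (syzygy^[d + n] X).obj (ModuleCat.of Λ Λ) i) := fun n X i hi =>
    subsingleton_ext_syzygy (d + n) hi (hd (i + (d + n)) (by omega) X.obj)
  -- The gap theorem gives `Extᵈ⁺¹(M, Ωʲ⁺ᵈN) = 0` with a degree independent of `j`. This is
  -- `Ext¹(ΩᵈM, Ωʲ⁺ᵈN)`, whose vanishing makes the maps from `Ωᵈ⁺¹M` extend to a projective.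
  have h1 : ∀ (j : ℕ) (f : syzygy^[d + 1] M ⟶ syzygy^[j] (syzygy^[d] N)),
      FactorsThroughProjective f := by
    intro j
    rw [Function.iterate_succ_apply', ← Function.iterate_add_apply]
    refine fun f => (projPres (syzygy^[d] M)).factorsThroughProjective
      (subsingleton_ext_syzygy d one_pos ?_) f
    exact subsingleton_ext_of_eventually hR h M.obj (syzygy^[j + d] N).obj
      (fun i hi => hd i hi.le M.obj)
      (eventually_ext_syzygy_right ⟨d, fun i hi => hd i hi M.obj⟩ (j + d) hMN) _ (by omega)
  obtain ⟨n, hn⟩ := hΛ.factorsThroughProjective (hMCM 1 M) (hMCM 0 N) h1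
  have h2 : ∃ m : ℕ, ∀ i, m ≤ i →
      Subsingleton (Ext.{u} N.obj (syzygy^[d + 1] M).obj i) := by
    -- Degree `n + d + 1 + l` for `N` is degree `1` for `Ωᵈ⁺ⁿ⁺ˡN`, whose syzygy is the `(n + l +
    -- 1)`-st syzygy of `ΩᵈN` and so falls in the range of `hn`.
    refine ⟨n + d + 1, fun i hi => ?_⟩
    obtain ⟨l, rfl⟩ := Nat.exists_eq_add_of_le hi
    have h3 : Subsingleton
        (Ext.{u} (syzygy^[d + (n + l)] N).obj (syzygy^[d + 1] M).obj 1) := by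
      refine (projPres _).subsingleton_ext_one (hMCM (n + l) N 1 one_pos) fun f => ?_
      have h4 := hn (n + l + 1) (by omega)
      rw [Function.iterate_succ_apply', ← Function.iterate_add_apply, add_zero,
        add_comm _ d] at h4
      exact h4 f
    have h5 := subsingleton_ext_add _ h3
    rwa [show 1 + (d + (n + l)) = n + d + 1 + l by omega] at h5
  exact eventually_ext_of_syzygy_right ⟨d, fun i hi => hd i hi N.obj⟩ (d + 1) h2

end Symmetry

theorem mainTheorem3
    {k : Type*} [CommRing k] [IsArtinianRing k]
    {Λ : Type u} [Ring Λ] [Algebra k Λ] [Module.Finite k Λ]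
    [HasDerivedCategory.{w} (ModuleCat.{u} Λ)]
    (E : Type*) [AddCommGroup E] [Module k E]
    (hE : ∀ m : Ideal k, m.IsMaximal → ∃ f : (k ⧸ m) →ₗ[k] E, Function.Injective f)
    (hΛ : IsStablySymmetric Λ k E)
    {R : Type*} [Ring R] (𝒜 : ℕ → AddSubgroup R) [GradedRing 𝒜] (hR : IsGradedCommutative 𝒜)
    (act : CentralAction (BoundedDerivedCategory Λ) 𝒜)
    (hfin : act.IsEventuallyNoetherianOfFiniteLength
      (BoundedDerivedCategory.ofModule (ModuleCat.of Λ (Λ ⧸ Ring.jacobson Λ)))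
      (BoundedDerivedCategory.ofModule (ModuleCat.of Λ (Λ ⧸ Ring.jacobson Λ))))
    (M N : ModuleCat.{u} Λ) [Module.Finite Λ M] [Module.Finite Λ N] :
    List.TFAE [
      ∃ n : ℕ, ∀ i : ℕ, n ≤ i → Subsingleton (Ext.{u} M N i),
      ∀ i : ℕ, injectiveDimension (ModuleCat.of Λ Λ) < (i : WithBot ℕ∞) →
        Subsingleton (Ext.{u} M N i),
      ∃ n : ℕ, ∀ i : ℕ, n ≤ i → Subsingleton (Ext.{u} N M i),
      ∀ i : ℕ, injectiveDimension (ModuleCat.of Λ Λ) < (i : WithBot ℕ∞) →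
        Subsingleton (Ext.{u} N M i)] := by
  have := isNoetherianRing_of_finite Λ k
  have : IsArtinianRing Λ := isArtinian_of_tower k (inferInstance : IsArtinian k Λ)
  have hfg : act.EventuallyNoetherian
      (BoundedDerivedCategory.ofModule (ModuleCat.of Λ (Λ ⧸ Ring.jacobson Λ)))
      (BoundedDerivedCategory.ofModule (ModuleCat.of Λ (Λ ⧸ Ring.jacobson Λ))) := hfin.1
  obtain ⟨d, hd⟩ := CentralAction.exists_hasInjectiveDimensionLT hfg
  have hlt : ∀ i : ℕ, d + 1 ≤ i → injectiveDimension (ModuleCat.of Λ Λ) < (i : WithBot ℕ∞) :=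
    fun i hi => injectiveDimension_lt_iff.2 (hasInjectiveDimensionLT_of_ge _ (d + 1) i hi)
  tfae_have 1 → 2 := fun h i hi =>
    CentralAction.subsingleton_ext_of_injectiveDimension_lt hR hfg M N h hi
  tfae_have 2 → 1 := fun h => ⟨d + 1, fun i hi => h i (hlt i hi)⟩
  tfae_have 3 → 4 := fun h i hi =>
    CentralAction.subsingleton_ext_of_injectiveDimension_lt hR hfg N M h hi
  tfae_have 4 → 3 := fun h => ⟨d + 1, fun i hi => h i (hlt i hi)⟩
  tfae_have 1 → 3 := hΛ.eventually_ext_symm hR hfg ⟨M, ‹_›⟩ ⟨N, ‹_›⟩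
  tfae_have 3 → 1 := hΛ.eventually_ext_symm hR hfg ⟨N, ‹_›⟩ ⟨M, ‹_›⟩
  tfae_finish
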